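/- Let $X=\begin{bmatrix}0&1\\1&0\end{bmatrix}$, $CX=I_2\oplus X$, $CCX=I_6\oplus X$ and $F=\frac12\begin{bmatrix}1+i\sqrt2&1\\1&-1+i\sqrt2\end{bmatrix}$. An ancilla-free $n$-qubit circuit over $\{X,CX,CCX,F\}$ is a finite sequence of gates from this set, each applied to distinct qubits, chosen in any order, among the $n$ qubits (and tensored with the identity on the remaining qubits); it exactly represents the $2^n\times 2^n$ matrix that is the product of these operators. Let $\mathbb{Z}[1/i\sqrt2]=\{x_0+x_1 i\sqrt2 : x_0,x_1\in\mathbb{Z}[1/2]\}$, and let $U_{2^n}(\mathbb{Z}[1/i\sqrt2])$ be the group of $2^n\times 2^n$ unitary matrices with entries in this ring. Let $n\ge 4$. A matrix $V\in U_{2^n}(\mathbb{Z}[1/i\sqrt2])$ can be exactly represented by an ancilla-free $n$-qubit circuit over $\{X,CX,CCX,F\}$ if and only if $\det V=1$. -/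

import Mathlib

open Matrix

noncomputable section

namespace ImaginaryCircuit

/-- The ring `𝔻 = ℤ[1/2]` of dyadic fractions `u / 2 ^ q`, as a set of complex numbers. -/
def dyadic : Set ℂ := {z | ∃ (u : ℤ) (q : ℕ), z = (u : ℂ) / 2 ^ q}

/-- The complex number `i√2`. -/
def iSqrtTwo : ℂ := Complex.I * (Real.sqrt 2 : ℂ)

/-- The ring `𝔻[i√2] = ℤ[1/(i√2)]`, that is, the numbers `x₀ + x₁ i√2` with `x₀, x₁` dyadic
fractions. -/
def dyadicSqrtNegTwo : Set ℂ :=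
  {z | ∃ x₀ ∈ dyadic, ∃ x₁ ∈ dyadic, z = x₀ + x₁ * iSqrtTwo}

/-- The computational basis states of `n` qubits. They index the rows and columns of a
`2 ^ n × 2 ^ n` matrix; qubit `0` is the most significant bit (leftmost tensor factor). -/
abbrev Bits (n : ℕ) : Type := Fin n → Fin 2

/-- The linear operators on `n` qubits: complex `2 ^ n × 2 ^ n` matrices. -/
abbrev Operator (n : ℕ) : Type := Matrix (Bits n) (Bits n) ℂ

/-- `U_{2 ^ n}(R)`: the `2 ^ n × 2 ^ n` unitary matrices all of whose entries lie in `R`. -/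
def unitaryOver (n : ℕ) (R : Set ℂ) : Set (Operator n) :=
  {V | V ∈ Matrix.unitaryGroup (Bits n) ℂ ∧ ∀ x y, V x y ∈ R}

/-- The `NOT` gate as a `2 × 2` matrix. -/
def matX : Matrix (Fin 2) (Fin 2) ℂ := !![0, 1; 1, 0]

/-- The `F` gate as a `2 × 2` matrix. -/
def matF : Matrix (Fin 2) (Fin 2) ℂ :=
  (1 / 2 : ℂ) • !![1 + iSqrtTwo, 1; 1, -1 + iSqrtTwo]

/-- A `2 × 2` matrix seen as an operator on one qubit. -/
def oneQubit (A : Matrix (Fin 2) (Fin 2) ℂ) : Operator 1 :=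
  fun x y => A (x 0) (y 0)

/-- The controlled gate `CG = I ⊕ G`: the first qubit is the control. -/
def controlled {k : ℕ} (G : Operator k) : Operator (k + 1) :=
  fun x y =>
    if x 0 = y 0 then
      if x 0 = 0 then (1 : Operator k) (Fin.tail x) (Fin.tail y)
      else G (Fin.tail x) (Fin.tail y)
    else 0

/-- The gate set `{X, CX, CCX, F}`. -/
inductive Gate : Type
  | X
  | CX
  | CCX
  | F

/-- The number of qubits a gate acts on. -/
def Gate.arity : Gate → ℕ
  | .X => 1
  | .CX => 2
  | .CCX => 3
  | .F => 1

/-- The matrix of a gate. -/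
def Gate.matrix : (g : Gate) → Operator g.arity
  | .X => oneQubit matX
  | .CX => controlled (oneQubit matX)
  | .CCX => controlled (controlled (oneQubit matX))
  | .F => oneQubit matF

/-- The action of a `k`-qubit operator `G` on the `k` distinct qubits `e 0, …, e (k - 1)` (in
this order) among `n` qubits: `G` on these qubits, tensored with the identity on all others. -/
def applyOn {n k : ℕ} (e : Fin k ↪ Fin n) (G : Operator k) : Operator n :=
  fun x y =>
    if ∀ q : Fin n, (∀ j : Fin k, e j ≠ q) → x q = y q then
      G (fun j => x (e j)) (fun j => y (e j))
    else 0

/-- A gate together with the ordered list of distinct qubits, among `n`, to which it is applied. -/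
structure PlacedGate (n : ℕ) : Type where
  gate : Gate
  wires : Fin gate.arity ↪ Fin n

/-- The operator on `n` qubits performed by a placed gate. -/
def PlacedGate.matrix {n : ℕ} (p : PlacedGate n) : Operator n :=
  applyOn p.wires p.gate.matrix

/-- An ancilla-free `n`-qubit circuit over `{X, CX, CCX, F}`: a finite sequence of gates from the
gate set, each applied to some of the `n` qubits; there are no further qubits. -/
abbrev Circuit (n : ℕ) : Type := List (PlacedGate n)

/-- The operator performed by a circuit; the head of the list is the gate that acts first. -/
def Circuit.matrix {n : ℕ} : Circuit n → Operator n
  | [] => 1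
  | p :: c => Circuit.matrix c * p.matrix

/-- `V` is exactly represented (on the nose, not up to a global phase) by an ancilla-free
`n`-qubit circuit over `{X, CX, CCX, F}`. -/
def AncillaFreeRepresentable {n : ℕ} (V : Operator n) : Prop :=
  ∃ c : Circuit n, Circuit.matrix c = V

end ImaginaryCircuit

end

/-! Necessity: with `4 ≤ n`, every placed `X`, `CX` or `CCX` leaves a wire `w` untouched. Such a
gate is a permutation that factors as a square of a product of two controlled nots, hence is even; a
placed `F` is block diagonal with an even number `2 ^ (n - 1)` of blocks of determinant `-1`. So
every gate has determinant 1 (`det_circuit`).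

Sufficiency has three ingredients. The gates `X`, `CX`, `CCX` produce every even permutation of the
basis states, by Jordan's theorem on primitive groups containing a three-cycle
(`alternatingGroup_le`). The relations `F ^ 4 = (F X) ^ 3 = -1`, together with even permutations and
`F` on all blocks, isolate `F X` on a single pair of basis states (`constOn_singleton_mem`,
`twoLevel_mem_representable`). Finally, a column-by-column reduction shows that every unitary over
the ring is a product of permutations and two-level `F`s (`dyadicUnitary_le_generated`).

Writing each two-level `F` as `(F X) X`, with `X` a transposition, and moving the permutations to
the right gives `V = W σ` with `W` representable (`exists_eq_mul_permMatrixHom`). Then `det V = sign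
σ`, so `det V = 1` makes `σ` even and therefore representable. -/

namespace ImaginaryCircuit

open Equiv Equiv.Perm
open scoped Pointwise

/-! ### Even permutations of bit strings from controlled nots. -/

section Permutations

/-- The product of the reflections `f`, `g` whose supports meet only in `p` yields a three-cycle. -/
lemma commutator_eq_swap_mul_swap {α : Type*} [DecidableEq α] {f g : Perm α} {p : α}
    (hf : ∀ x, f (f x) = x) (hg : ∀ x, g (g x) = x) (hfp : f p ≠ p) (hgp : g p ≠ p)
    (h : ∀ x, f x ≠ x → g x ≠ x → x = p) :
    f * g * f * g = swap p (g p) * swap p (f p) := by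
  have hgf : g (f p) = f p := by
    by_contra hne
    exact hfp (h (f p) (by rw [hf]; exact hfp.symm) hne)
  have hfg : f (g p) = g p := by
    by_contra hne
    exact hgp (h (g p) hne (by rw [hg]; exact hgp.symm))
  have hne : f p ≠ g p := fun e => hgp (by rw [← e, ← hgf, e, hg] )
  ext x
  simp only [Perm.mul_apply]
  by_cases hxp : x = p
  · subst hxp
    rw [hfg, hg, swap_apply_left, swap_apply_of_ne_of_ne hfp hne]
  by_cases hxf : x = f p
  · subst hxf
    rw [hgf, hf, hfg, swap_apply_right, swap_apply_left]
  by_cases hxg : x = g p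
  · subst hxg
    rw [hg, hgf, hf, swap_apply_of_ne_of_ne hgp hne.symm, swap_apply_right]
  rw [swap_apply_of_ne_of_ne hxp hxf, swap_apply_of_ne_of_ne hxp hxg]
  by_cases hgx : g x = x
  · rw [hgx]
    by_cases hfx : f x = x
    · rw [hfx, hgx, hfx]
    · have : g (f x) = f x := by
        by_contra hn
        have := h (f x) (by rw [hf]; exact fun e => hfx e.symm) hn
        exact hxf (by rw [← this, hf])
      rw [this, hf]
  · have hfx : f x = x := by
      by_contra hn
      exact hxp (h x hn hgx)
    have : f (g x) = g x := by
      by_contra hn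
      have := h (g x) hn (by rw [hg]; exact fun e => hgx e.symm)
      exact hxg (by rw [← this, hg])
    rw [this, hg, hfx]

variable {n : ℕ}

/-- Bit strings under XOR are generated by the unit vectors. This serves both to build all
translations from `X` gates and to show that a block is closed under all translations. -/
lemma bits_induction {P : Bits n → Prop} (h0 : P 0) (hadd : ∀ a b, P a → P b → P (a + b))
    (hs : ∀ i, P (Pi.single i 1)) (m : Bits n) : P m := by
  rw [← Finset.univ_sum_single m]
  refine Finset.sum_induction _ P hadd h0 fun i _ => ?_
  rcases (by generalize m i = b; revert b; decide : m i = 0 ∨ m i = 1) with h | h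
  · rw [h, Pi.single_zero]; exact h0
  · rw [h]; exact hs i

lemma fin_two_add_self (a : Fin 2) : a + a = 0 := by revert a; decide

lemma bits_add_self (x : Bits n) : x + x = 0 := funext fun i => fin_two_add_self (x i)

/-- The condition that the wires of `A` other than `t` carry the bits of `p`. -/
def Matches (A : Finset (Fin n)) (p : Bits n) (t : Fin n) (x : Bits n) : Prop :=
  ∀ a ∈ A, a ≠ t → x a = p a

instance (A : Finset (Fin n)) (p : Bits n) (t : Fin n) (x : Bits n) :
    Decidable (Matches A p t x) := by unfold Matches; infer_instance

lemma matches_add_single (A : Finset (Fin n)) (p : Bits n) (t : Fin n) (x : Bits n) (b : Fin 2) :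
    Matches A p t (x + Pi.single t b) ↔ Matches A p t x := by
  refine forall_congr' fun a => forall_congr' fun _ => forall_congr' fun h => ?_
  simp [h]

lemma add_single_add_single (x : Bits n) (t : Fin n) (b : Fin 2) :
    x + Pi.single t b + Pi.single t b = x := by
  rw [add_assoc, bits_add_self, add_zero]

/-- The permutation flipping bit `t` when the wires of `A` other than `t` carry the bits of `p`. -/
def ctrlNot (A : Finset (Fin n)) (p : Bits n) (t : Fin n) : Perm (Bits n) :=
  Function.Involutive.toPerm
    (fun x => if Matches A p t x then x + Pi.single t 1 else x) (fun x => by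
      by_cases h : Matches A p t x
      · simp only [if_pos h, if_pos ((matches_add_single A p t x 1).2 h), add_single_add_single]
      · simp only [if_neg h])

lemma ctrlNot_apply (A : Finset (Fin n)) (p : Bits n) (t : Fin n) (x : Bits n) :
    ctrlNot A p t x = if Matches A p t x then x + Pi.single t 1 else x := rfl

lemma ctrlNot_apply_apply (A : Finset (Fin n)) (p : Bits n) (t : Fin n) (x : Bits n) :
    ctrlNot A p t (ctrlNot A p t x) = x := by
  by_cases h : Matches A p t x
  · simp only [ctrlNot_apply, if_pos h, if_pos ((matches_add_single A p t x 1).2 h),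
      add_single_add_single]
  · simp only [ctrlNot_apply, if_neg h]

lemma ctrlNot_apply_ne {A : Finset (Fin n)} {p : Bits n} {t : Fin n} {x : Bits n}
    (h : ctrlNot A p t x ≠ x) : Matches A p t x := by
  by_contra hn
  exact h (by rw [ctrlNot_apply, if_neg hn])

lemma add_single_one_ne (x : Bits n) (t : Fin n) : x + Pi.single t 1 ≠ x := by
  intro h
  have := congrFun h t
  simp at this

/-- The wire `w` carries an intermediate control bit. -/
lemma ctrlNot_commutator {A B : Finset (Fin n)} {p : Bits n} {t w : Fin n} (hwt : w ≠ t)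
    (hwA : w ∉ A) (hwB : w ∉ B) (htA : t ∉ A) :
    ctrlNot (A ∪ B) p t = ctrlNot A p w * ctrlNot (insert w B) p t * ctrlNot A p w *
      ctrlNot (insert w B) p t := by
  have hA : ∀ x b, Matches A p w (x + Pi.single t b) ↔ Matches A p w x := fun x b => by
    refine forall_congr' fun a => forall_congr' fun ha => forall_congr' fun h => ?_
    have : a ≠ t := fun e => htA (e ▸ ha)
    simp [this]
  have hB : ∀ x, Matches (insert w B) p t x ↔ x w = p w ∧ Matches B p t x := fun x => by
    simp [Matches, hwt]
  have hBw : ∀ x b, Matches B p t (x + Pi.single w b) ↔ Matches B p t x := fun x b => by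
    refine forall_congr' fun a => forall_congr' fun ha => forall_congr' fun h => ?_
    have : a ≠ w := fun e => hwB (e ▸ ha)
    simp [this]
  have hAB : ∀ x, Matches (A ∪ B) p t x ↔ Matches A p w x ∧ Matches B p t x := fun x => by
    simp only [Matches, Finset.mem_union]
    constructor
    · exact fun h => ⟨fun a ha _ => h a (Or.inl ha) (fun e => htA (e ▸ ha)),
        fun a ha hat => h a (Or.inr ha) hat⟩
    · rintro ⟨h1, h2⟩ a (ha | ha) hat
      · exact h1 a ha (fun e => hwA (e ▸ ha))
      · exact h2 a ha hat
  have hflip : ∀ a b : Fin 2, a + 1 = b ↔ ¬ a = b := by decide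
  ext1 x
  simp only [Perm.mul_apply, ctrlNot_apply, hAB, hB]
  by_cases h1 : Matches A p w x <;> by_cases h2 : Matches B p t x <;>
    by_cases h3 : x w = p w <;>
    simp [h1, h2, h3, hA, hBw, matches_add_single, hwt, hflip, add_single_add_single]
  all_goals rw [add_right_comm x, add_single_add_single]

/-- With a spare wire the permutation has the form `f g f g`, a square, so its sign is 1. -/
lemma sign_ctrlNot {A B : Finset (Fin n)} {p : Bits n} {t w : Fin n} (hwt : w ≠ t)
    (hwA : w ∉ A) (hwB : w ∉ B) (htA : t ∉ A) :
    sign (ctrlNot (A ∪ B) p t) = 1 := by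
  rw [ctrlNot_commutator hwt hwA hwB htA]
  simp only [Perm.sign_mul]
  rw [mul_assoc (_ * _), Int.units_mul_self]

lemma ctrlNot_translate (A : Finset (Fin n)) (p m : Bits n) (t : Fin n) :
    ctrlNot A (p + m) t = Equiv.addRight m * ctrlNot A p t * Equiv.addRight m := by
  have hm : ∀ x, Matches A (p + m) t x ↔ Matches A p t (x + m) := fun x => by
    refine forall_congr' fun a => forall_congr' fun ha => forall_congr' fun h => ?_
    have : ∀ a b c : Fin 2, a = b + c ↔ a + c = b := by decide
    exact this _ _ _
  ext1 x
  simp only [Perm.mul_apply, ctrlNot_apply, hm, Equiv.coe_addRight]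
  split_ifs
  · rw [add_right_comm, add_right_comm x, add_assoc x, bits_add_self, add_zero]
  · rw [add_assoc, bits_add_self, add_zero]

lemma ctrlNot_empty (p : Bits n) (t : Fin n) : ctrlNot ∅ p t = Equiv.addRight (Pi.single t 1) := by
  ext1 x
  simp [ctrlNot_apply, Matches]

variable {J : Subgroup (Perm (Bits n))}

lemma addRight_mem (h0 : ∀ t, ctrlNot ∅ 1 t ∈ J) (m : Bits n) : Equiv.addRight m ∈ J := by
  refine bits_induction (P := fun m => Equiv.addRight m ∈ J) ?_ ?_ ?_ m
  · convert J.one_mem using 1; ext1 x; simp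
  · intro a b ha hb
    convert J.mul_mem hb ha using 1
    ext1 x; simp [add_assoc]
  · intro i; rw [← ctrlNot_empty 1]; exact h0 i

/-- Conjugation by `X` gates turns control pattern `1` into any `p`. Controls are then added one at
a time through the borrowed wire `w`; in the induction hypothesis `t` and `w` exchange roles, so one
spare wire suffices throughout. -/
lemma ctrlNot_mem (h : ∀ (A : Finset (Fin n)) t, A.card ≤ 2 → t ∉ A → ctrlNot A 1 t ∈ J)
    (p : Bits n) (A : Finset (Fin n)) :
    ∀ t w, w ≠ t → t ∉ A → w ∉ A → ctrlNot A p t ∈ J := by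
  have hT := addRight_mem (J := J) (fun t => h ∅ t (by simp) (by simp))
  have h2 : ∀ (A : Finset (Fin n)) t, A.card ≤ 2 → t ∉ A → ctrlNot A p t ∈ J := by
    intro A t hc ht
    have := ctrlNot_translate A 1 (1 + p) t
    rw [← add_assoc, bits_add_self, zero_add] at this
    rw [this]
    exact J.mul_mem (J.mul_mem (hT _) (h A t hc ht)) (hT _)
  induction A using Finset.induction_on with
  | empty => exact fun t w _ ht _ => h2 ∅ t (by simp) ht
  | insert a A ha ih =>
    intro t w hwt ht hw
    simp only [Finset.mem_insert, not_or] at ht hw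
    have key : insert a A = A ∪ {a} := by rw [Finset.union_comm]; rfl
    rw [key, ctrlNot_commutator hwt hw.2 (by simpa using hw.1) ht.2]
    have m1 := ih w t hwt.symm hw.2 ht.2
    have m2 : ctrlNot (insert w {a}) p t ∈ J :=
      h2 _ _ (Finset.card_le_two) (by simp [hwt.symm, ht.1])
    exact J.mul_mem (J.mul_mem (J.mul_mem m1 m2) m1) m2

/-- With `i, j, w, w'` distinct, take the not on `i` controlled by all wires except `i, w`, and the
not on `j` controlled by all except `j, w'`. A state moved by both agrees with `p` on every wire, so
the supports meet only in `p` and the commutator is a three-cycle. -/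
lemma threeCycle_mem (hn : 4 ≤ n)
    (h : ∀ (A : Finset (Fin n)) t, A.card ≤ 2 → t ∉ A → ctrlNot A 1 t ∈ J)
    (p : Bits n) {i j : Fin n} (hij : i ≠ j) :
    swap p (p + Pi.single j 1) * swap p (p + Pi.single i 1) ∈ J := by
  obtain ⟨w, hw⟩ : ∃ w, w ∉ ({i, j} : Finset (Fin n)) := by
    by_contra! hall
    have := Finset.card_le_card (fun x _ => hall x : (Finset.univ : Finset (Fin n)) ⊆ {i, j})
    have := Finset.card_le_two (a := i) (b := j)
    simp at *; omega
  obtain ⟨w', hw'⟩ : ∃ w', w' ∉ ({i, j, w} : Finset (Fin n)) := by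
    by_contra! hall
    have := Finset.card_le_card (fun x _ => hall x : (Finset.univ : Finset (Fin n)) ⊆ {i, j, w})
    have := Finset.card_le_three (a := i) (b := j) (c := w)
    simp at *; omega
  simp only [Finset.mem_insert, Finset.mem_singleton, not_or] at hw hw'
  have m1 := ctrlNot_mem h p (Finset.univ \ {i, w}) i w hw.1 (by simp) (by simp)
  have m2 := ctrlNot_mem h p (Finset.univ \ {j, w'}) j w' hw'.2.1 (by simp) (by simp)
  have e1 : ∀ A t, Matches A p t p := fun A t a _ _ => rfl
  have v1 : ∀ A t, ctrlNot A p t p = p + Pi.single t 1 := fun A t => by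
    rw [ctrlNot_apply, if_pos (e1 A t)]
  have key := commutator_eq_swap_mul_swap (f := ctrlNot (Finset.univ \ {i, w}) p i)
    (g := ctrlNot (Finset.univ \ {j, w'}) p j) (p := p) (ctrlNot_apply_apply _ _ _)
    (ctrlNot_apply_apply _ _ _) (by rw [v1]; exact add_single_one_ne _ _)
    (by rw [v1]; exact add_single_one_ne _ _) (by
      intro x h1 h2
      have h1 := ctrlNot_apply_ne h1
      have h2 := ctrlNot_apply_ne h2
      funext a
      by_cases ha : a = i ∨ a = w
      · refine h2 a ?_ ?_
        · simp; rcases ha with rfl | rfl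
          · exact ⟨hij, fun e => hw'.1 e.symm⟩
          · exact ⟨hw.2, fun e => hw'.2.2 e.symm⟩
        · rcases ha with rfl | rfl
          exacts [hij, hw.2]
      · exact h1 a (by simpa using ha) (fun e => ha (Or.inl e)))
  rw [v1, v1] at key
  rw [← key]
  exact J.mul_mem (J.mul_mem (J.mul_mem m1 m2) m1) m2

/-- Jordan's theorem: a primitive group containing a three-cycle contains the alternating group.
Translations give transitivity; three-cycles rule out nontrivial blocks. -/
lemma alternatingGroup_le (hn : 4 ≤ n)
    (h : ∀ (A : Finset (Fin n)) t, A.card ≤ 2 → t ∉ A → ctrlNot A 1 t ∈ J) :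
    alternatingGroup (Bits n) ≤ J := by
  have hT := addRight_mem (J := J) (fun t => h ∅ t (by simp) (by simp))
  let i0 : Fin n := ⟨0, by omega⟩
  let i1 : Fin n := ⟨1, by omega⟩
  have h01 : i0 ≠ i1 := by simp [i0, i1, Fin.ext_iff]
  have hne : ∀ (p : Bits n) (i j : Fin n), i ≠ j → p + Pi.single i 1 ≠ p + Pi.single j 1 := by
    intro p i j hij e
    have := congrFun e i
    simp [hij] at this
  have hprim : MulAction.IsPreprimitive J (Bits n) := by
    have : MulAction.IsPretransitive J (Bits n) := ⟨fun x y => by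
      refine ⟨⟨_, hT (x + y)⟩, ?_⟩
      change x + (x + y) = y
      rw [← add_assoc, bits_add_self, zero_add]⟩
    refine ⟨fun {B} hB => ?_⟩
    rw [MulAction.IsTrivialBlock, or_iff_not_imp_left, Set.not_subsingleton_iff]
    intro hnt
    have step : ∀ m : Bits n, ∀ x ∈ B, x + m ∈ B := by
      refine bits_induction (by simp) (fun a b ha hb x hx => ?_) (fun i x hx => ?_)
      · rw [← add_assoc]; exact hb _ (ha _ hx)
      · obtain ⟨j, hij⟩ : ∃ j, i ≠ j := by
          by_cases e : i = i0
          · exact ⟨i1, e ▸ h01⟩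
          · exact ⟨i0, e⟩
        have hc := threeCycle_mem hn h x hij
        set c := swap x (x + Pi.single j 1) * swap x (x + Pi.single i 1) with hcdef
        have hsm : ∀ y : Bits n, (⟨c, hc⟩ : J) • y = c y := fun y => rfl
        obtain ⟨u, hu, hux⟩ := hnt.exists_ne x
        have c1 : c x = x + Pi.single i 1 := by
          rw [hcdef, Perm.mul_apply, swap_apply_left,
            swap_apply_of_ne_of_ne (add_single_one_ne _ _) (hne _ _ _ hij)]
        have c2 : c (x + Pi.single j 1) = x := by
          rw [hcdef, Perm.mul_apply, swap_apply_of_ne_of_ne (add_single_one_ne _ _)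
            (hne _ _ _ hij.symm), swap_apply_right]
        by_cases hui : u = x + Pi.single i 1
        · exact hui ▸ hu
        have hcu : c u ∈ B := by
          by_cases huj : u = x + Pi.single j 1
          · rw [huj, c2]; exact hx
          · rw [hcdef, Perm.mul_apply, swap_apply_of_ne_of_ne hux hui,
              swap_apply_of_ne_of_ne hux huj]; exact hu
        have heq : (⟨c, hc⟩ : J) • B = B := hB.smul_eq_of_mem hu hcu
        rw [← heq, ← c1]
        exact Set.smul_mem_smul_set hx
    obtain ⟨x, hx⟩ := hnt.nonempty
    refine Set.eq_univ_of_forall fun y => ?_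
    have := step (x + y) x hx
    rwa [← add_assoc, bits_add_self, zero_add] at this
  refine alternatingGroup_le_of_isPreprimitive_of_isThreeCycle_mem hprim
    (isThreeCycle_swap_mul_swap_same (add_single_one_ne _ _).symm (add_single_one_ne _ _).symm
      (hne _ _ _ h01.symm)) (threeCycle_mem hn h 0 h01)

end Permutations

/-! ### Permutation matrices and two-level operators. -/

section TwoLevel

variable {ι : Type*} [Fintype ι] [DecidableEq ι]

lemma permMatrixHom_apply' (σ : Perm ι) (x y : ι) :
    permMatrixHom (R := ℂ) σ x y = if x = σ y then 1 else 0 := by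
  simp only [permMatrixHom_apply, PEquiv.toMatrix_apply, Equiv.toPEquiv_apply, Option.mem_def,
    Option.some.injEq, Equiv.Perm.inv_eq_iff_eq]

lemma permMatrixHom_mulVec (σ : Perm ι) (v : ι → ℂ) :
    permMatrixHom (R := ℂ) σ *ᵥ v = v ∘ ⇑σ⁻¹ := by
  rw [permMatrixHom_apply, permMatrix_mulVec]

lemma det_permMatrixHom (σ : Perm ι) : (permMatrixHom (R := ℂ) σ).det = (sign σ : ℤ) := by
  rw [permMatrixHom_apply, det_permutation, sign_inv]

/-- The `2 × 2` matrix `M` acting on the coordinates `a` and `b`. -/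
def twoLevel (a b : ι) (M : Matrix (Fin 2) (Fin 2) ℂ) : Matrix ι ι ℂ := fun x y =>
  if x = a then (if y = a then M 0 0 else if y = b then M 0 1 else 0)
  else if x = b then (if y = a then M 1 0 else if y = b then M 1 1 else 0)
  else if x = y then 1 else 0

lemma twoLevel_mulVec {a b : ι} (hab : a ≠ b) (M : Matrix (Fin 2) (Fin 2) ℂ) (v : ι → ℂ) :
    twoLevel a b M *ᵥ v = fun x => if x = a then M 0 0 * v a + M 0 1 * v b
      else if x = b then M 1 0 * v a + M 1 1 * v b else v x := by
  have key : ∀ c d : ℂ, ∑ y, (if y = a then c else if y = b then d else 0) * v y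
      = c * v a + d * v b := fun c d => by
    have : ∀ y, (if y = a then c else if y = b then d else 0) * v y
        = (if y = a then c * v y else 0) + (if y = b then d * v y else 0) := fun y => by
      by_cases h : y = a
      · simp [h, hab]
      · simp [h]
    simp [this, Finset.sum_add_distrib]
  funext x
  simp only [mulVec, dotProduct, twoLevel]
  split_ifs
  · exact key _ _
  · exact key _ _
  · simp

lemma matrix_ext_mulVec {A B : Matrix ι ι ℂ} (h : ∀ v, A *ᵥ v = B *ᵥ v) : A = B :=
  Matrix.toLin'.injective (LinearMap.ext h)

lemma twoLevel_mul {a b : ι} (hab : a ≠ b) (M N : Matrix (Fin 2) (Fin 2) ℂ) :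
    twoLevel a b M * twoLevel a b N = twoLevel a b (M * N) := by
  refine matrix_ext_mulVec fun v => ?_
  rw [← mulVec_mulVec, twoLevel_mulVec hab, twoLevel_mulVec hab, twoLevel_mulVec hab]
  funext x
  simp only [Matrix.mul_apply, Fin.sum_univ_two, if_pos, if_neg hab.symm]
  split_ifs <;> ring

lemma twoLevel_conj (σ : Perm ι) {a b : ι} (hab : a ≠ b) (M : Matrix (Fin 2) (Fin 2) ℂ) :
    permMatrixHom (R := ℂ) σ * twoLevel a b M * permMatrixHom (R := ℂ) σ⁻¹
      = twoLevel (σ a) (σ b) M := by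
  refine matrix_ext_mulVec fun v => ?_
  rw [← mulVec_mulVec, ← mulVec_mulVec, permMatrixHom_mulVec, permMatrixHom_mulVec,
    twoLevel_mulVec hab, twoLevel_mulVec (σ.injective.ne hab)]
  funext x
  simp [Equiv.symm_apply_eq]

lemma twoLevel_matX {a b : ι} (hab : a ≠ b) :
    twoLevel a b matX = permMatrixHom (R := ℂ) (swap a b) := by
  refine matrix_ext_mulVec fun v => ?_
  rw [twoLevel_mulVec hab, permMatrixHom_mulVec]
  funext x
  simp only [matX, swap_inv, Function.comp, swap_apply_def]
  split_ifs <;> simp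

end TwoLevel

/-! ### Relations between `F` and `X`. -/

section GateIdentities

lemma iSqrtTwo_sq : iSqrtTwo ^ 2 = -2 := by
  rw [iSqrtTwo, mul_pow, Complex.I_sq, ← Complex.ofReal_pow]
  norm_num

lemma matX_mul_self : matX * matX = 1 := by
  ext i j; fin_cases i <;> fin_cases j <;> simp [matX]

/-- `F ^ 2` is `i` times the Hadamard matrix. -/
lemma matF_mul_self :
    matF * matF = (iSqrtTwo / 2) • !![1, 1; 1, -1] := by
  have h := iSqrtTwo_sq
  ext i j; fin_cases i <;> fin_cases j <;> simp [matF, Matrix.mul_apply, Fin.sum_univ_two] <;>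
    ring_nf <;> simp [h] <;> ring

/-- Hence `F ^ 8 = 1`, and `F ^ 7` serves as the inverse of `F` in a monoid of circuits. -/
lemma matF_pow_four : matF ^ 4 = -1 := by
  have h := iSqrtTwo_sq
  have : matF ^ 4 = (matF * matF) * (matF * matF) := by noncomm_ring
  rw [this, matF_mul_self]
  ext i j; fin_cases i <;> fin_cases j <;> simp [Matrix.mul_apply, Fin.sum_univ_two] <;>
    ring_nf <;> simp [h]

lemma matF_mul_matX_pow_three : (matF * matX) ^ 3 = -1 := by
  have h := iSqrtTwo_sq
  have h3 : iSqrtTwo ^ 3 = -2 * iSqrtTwo := by rw [pow_succ, h]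
  have : matF * matX = (1 / 2 : ℂ) • !![1, 1 + iSqrtTwo; -1 + iSqrtTwo, 1] := by
    ext i j; fin_cases i <;> fin_cases j <;>
      simp [matF, matX, Matrix.mul_apply, Fin.sum_univ_two]
  rw [this]
  ext i j; fin_cases i <;> fin_cases j <;>
    simp [pow_succ, Matrix.mul_apply, Fin.sum_univ_two] <;>
    ring_nf <;> simp [h, h3] <;> ring

lemma matF_mul_pow_seven : matF * matF ^ 7 = 1 := by
  have : matF * matF ^ 7 = matF ^ 4 * matF ^ 4 := by noncomm_ring
  rw [this, matF_pow_four]; simp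

lemma matF_pow_seven_mul : matF ^ 7 * matF = 1 := by
  rw [← matF_mul_pow_seven]; noncomm_ring

lemma det_matF : matF.det = -1 := by
  have h := iSqrtTwo_sq
  simp [matF, Matrix.det_fin_two]
  ring_nf; simp [h]; norm_num

end GateIdentities

/-! ### Gates as permutations or block operators, and their determinants. -/

section Gates

variable {n : ℕ}

lemma Circuit.matrix_append (c d : Circuit n) :
    Circuit.matrix (c ++ d) = Circuit.matrix d * Circuit.matrix c := by
  induction c with
  | nil => simp [Circuit.matrix]
  | cons p c ih => simp only [List.cons_append, Circuit.matrix, ih, mul_assoc]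

/-- The operators performed by circuits. -/
def representable (n : ℕ) : Submonoid (Operator n) where
  carrier := {V | AncillaFreeRepresentable V}
  one_mem' := ⟨[], rfl⟩
  mul_mem' := by
    rintro _ _ ⟨c, rfl⟩ ⟨d, rfl⟩
    exact ⟨d ++ c, Circuit.matrix_append d c⟩

lemma PlacedGate.matrix_mem (p : PlacedGate n) : p.matrix ∈ representable n :=
  ⟨[p], by simp [Circuit.matrix]⟩

lemma oneQubit_matX_apply (x y : Bits 1) :
    oneQubit matX x y = if x 0 = y 0 + 1 then 1 else 0 := by
  unfold oneQubit
  generalize x 0 = a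
  generalize y 0 = b
  fin_cases a <;> fin_cases b <;> simp [matX]

lemma controlled_matX_apply (x y : Bits 2) :
    controlled (oneQubit matX) x y =
      if x 0 = y 0 ∧ x 1 = (if y 0 = 1 then y 1 + 1 else y 1) then 1 else 0 := by
  simp only [controlled, oneQubit_matX_apply, Matrix.one_apply, funext_iff, Fin.forall_fin_one,
    Fin.tail, Fin.succ_zero_eq_one]
  generalize x 0 = a
  generalize y 0 = b
  fin_cases a <;> fin_cases b <;> (simp; try congr)

lemma controlled_controlled_matX_apply (x y : Bits 3) :
    controlled (controlled (oneQubit matX)) x y =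
      if x 0 = y 0 ∧ x 1 = y 1 ∧ x 2 = (if y 0 = 1 ∧ y 1 = 1 then y 2 + 1 else y 2)
        then 1 else 0 := by
  rw [controlled]
  simp only [controlled_matX_apply, Matrix.one_apply, funext_iff, Fin.tail,
    Fin.succ_zero_eq_one, Fin.succ_one_eq_two]
  generalize x 0 = a
  generalize y 0 = b
  fin_cases a <;> fin_cases b <;> (simp; try congr)

lemma applyOn_matX (e : Fin 1 ↪ Fin n) :
    applyOn e (oneQubit matX) = permMatrixHom (R := ℂ) (ctrlNot ∅ 1 (e 0)) := by
  ext x y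
  rw [applyOn, oneQubit_matX_apply, permMatrixHom_apply', ← ite_and]
  refine if_congr ?_ rfl rfl
  rw [ctrlNot_apply, if_pos (by simp [Matches]), funext_iff]
  simp only [Fin.forall_fin_one]
  constructor
  · rintro ⟨h1, h2⟩ q
    by_cases hq : e 0 = q
    · subst hq; simp [h2]
    · simp [h1 q hq, Ne.symm hq]
  · intro h
    exact ⟨fun q hq => by simp [h q, Ne.symm hq], by simp [h (e 0)]⟩

lemma applyOn_controlled_matX (e : Fin 2 ↪ Fin n) :
    applyOn e (controlled (oneQubit matX)) =
      permMatrixHom (R := ℂ) (ctrlNot {e 0} 1 (e 1)) := by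
  have h01 : e 0 ≠ e 1 := e.injective.ne (by decide)
  ext x y
  rw [applyOn, controlled_matX_apply, permMatrixHom_apply', ← ite_and]
  refine if_congr ?_ rfl rfl
  have hm : Matches {e 0} 1 (e 1) y ↔ y (e 0) = 1 := by simp [Matches, h01]
  have hv : ∀ q, ctrlNot {e 0} 1 (e 1) y q = if q = e 1 then
      (if y (e 0) = 1 then y (e 1) + 1 else y (e 1)) else y q := fun q => by
    rw [ctrlNot_apply]; simp only [hm]
    by_cases hq : q = e 1
    · subst hq; rw [if_pos rfl]; split_ifs <;> simp
    · split_ifs <;> simp [hq]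
  rw [funext_iff]
  simp only [hv, Fin.forall_fin_two]
  constructor
  · rintro ⟨h1, h2, h3⟩ q
    by_cases hq1 : q = e 1
    · subst hq1; rw [if_pos rfl]; exact h3
    · rw [if_neg hq1]
      by_cases hq0 : q = e 0
      · subst hq0; exact h2
      · exact h1 q ⟨Ne.symm hq0, Ne.symm hq1⟩
  · intro h
    refine ⟨fun q hq => ?_, ?_, ?_⟩
    · rw [h q, if_neg (Ne.symm hq.2)]
    · rw [h (e 0), if_neg h01]
    · rw [h (e 1), if_pos rfl]

lemma applyOn_controlled_controlled_matX (e : Fin 3 ↪ Fin n) :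
    applyOn e (controlled (controlled (oneQubit matX))) =
      permMatrixHom (R := ℂ) (ctrlNot {e 0, e 1} 1 (e 2)) := by
  have h02 : e 0 ≠ e 2 := e.injective.ne (by decide)
  have h12 : e 1 ≠ e 2 := e.injective.ne (by decide)
  ext x y
  rw [applyOn, controlled_controlled_matX_apply, permMatrixHom_apply', ← ite_and]
  refine if_congr ?_ rfl rfl
  have hm : Matches {e 0, e 1} 1 (e 2) y ↔ y (e 0) = 1 ∧ y (e 1) = 1 := by
    simp [Matches, h02, h12]
  have hv : ∀ q, ctrlNot {e 0, e 1} 1 (e 2) y q = if q = e 2 then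
      (if y (e 0) = 1 ∧ y (e 1) = 1 then y (e 2) + 1 else y (e 2)) else y q := fun q => by
    rw [ctrlNot_apply]; simp only [hm]
    by_cases hq : q = e 2
    · subst hq; rw [if_pos rfl]; split_ifs <;> simp
    · split_ifs <;> simp [hq]
  rw [funext_iff]
  simp only [hv, Fin.forall_fin_succ, Fin.succ_zero_eq_one, Fin.succ_one_eq_two]
  constructor
  · rintro ⟨h1, h2, h3, h4⟩ q
    by_cases hq2 : q = e 2
    · subst hq2; rw [if_pos rfl]; exact h4
    · rw [if_neg hq2]
      by_cases hq0 : q = e 0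
      · subst hq0; exact h2
      by_cases hq1 : q = e 1
      · subst hq1; exact h3
      · exact h1 q ⟨Ne.symm hq0, Ne.symm hq1, Ne.symm hq2, by simp⟩
  · intro h
    refine ⟨fun q hq => ?_, ?_, ?_, ?_⟩
    · rw [h q, if_neg (Ne.symm hq.2.2.1)]
    · rw [h (e 0), if_neg h02]
    · rw [h (e 1), if_neg h12]
    · rw [h (e 2), if_pos rfl]

lemma PlacedGate.matrix_X (e : Fin 1 ↪ Fin n) :
    PlacedGate.matrix ⟨.X, e⟩ = permMatrixHom (R := ℂ) (ctrlNot ∅ 1 (e 0)) :=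
  applyOn_matX e

lemma PlacedGate.matrix_CX (e : Fin 2 ↪ Fin n) :
    PlacedGate.matrix ⟨.CX, e⟩ = permMatrixHom (R := ℂ) (ctrlNot {e 0} 1 (e 1)) :=
  applyOn_controlled_matX e

lemma PlacedGate.matrix_CCX (e : Fin 3 ↪ Fin n) :
    PlacedGate.matrix ⟨.CCX, e⟩ = permMatrixHom (R := ℂ) (ctrlNot {e 0, e 1} 1 (e 2)) :=
  applyOn_controlled_controlled_matX e

/-- The permutations of the basis states performed by circuits. -/
def representablePerm (n : ℕ) : Subgroup (Perm (Bits n)) where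
  carrier := {σ | permMatrixHom (R := ℂ) σ ∈ representable n}
  one_mem' := by simpa only [Set.mem_ofPred_eq, map_one] using one_mem _
  mul_mem' {a b} ha hb := by
    simpa only [Set.mem_ofPred_eq, map_mul] using (representable n).mul_mem ha hb
  inv_mem' {a} ha := by
    -- Circuits form only a monoid a priori; finite order supplies inverses.
    have h : a⁻¹ = a ^ (orderOf a - 1) := by
      rw [inv_eq_iff_mul_eq_one, ← pow_succ', Nat.sub_add_cancel (orderOf_pos a),
        pow_orderOf_eq_one]
    simpa only [Set.mem_ofPred_eq, h, map_pow] using (representable n).pow_mem ha _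

lemma ctrlNot_mem_representablePerm (A : Finset (Fin n)) (t : Fin n) (hA : A.card ≤ 2)
    (ht : t ∉ A) : ctrlNot A 1 t ∈ representablePerm n := by
  change _ ∈ representable n
  interval_cases h : A.card
  · rw [Finset.card_eq_zero] at h
    subst h
    have := PlacedGate.matrix_mem ⟨.X, (⟨![t], Function.injective_of_subsingleton _⟩ :
      Fin 1 ↪ Fin n)⟩
    rw [PlacedGate.matrix_X] at this
    exact this
  · obtain ⟨a, rfl⟩ := Finset.card_eq_one.1 h
    have hta : t ≠ a := by simpa using ht
    have := PlacedGate.matrix_mem ⟨.CX, (⟨![a, t], by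
      intro i j; fin_cases i <;> fin_cases j <;> simp [hta, hta.symm]⟩ : Fin 2 ↪ Fin n)⟩
    rw [PlacedGate.matrix_CX] at this
    exact this
  · obtain ⟨a, b, hab, rfl⟩ := Finset.card_eq_two.1 h
    simp only [Finset.mem_insert, Finset.mem_singleton, not_or] at ht
    have := PlacedGate.matrix_mem ⟨.CCX, (⟨![a, b, t], by
      intro i j; fin_cases i <;> fin_cases j <;>
        simp [ht.1, ht.2, hab, Ne.symm ht.1, Ne.symm ht.2, hab.symm]⟩ : Fin 3 ↪ Fin n)⟩
    rw [PlacedGate.matrix_CCX] at this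
    exact this

lemma permMatrixHom_mem_representable (hn : 4 ≤ n) {σ : Perm (Bits n)} (hσ : sign σ = 1) :
    permMatrixHom (R := ℂ) σ ∈ representable n :=
  alternatingGroup_le hn ctrlNot_mem_representablePerm (mem_alternatingGroup.2 hσ)

/-- The operator acting by the matrix `f z` on qubit `q` when the other qubits are in state `z`. -/
def blockOp (q : Fin n) :
    (({j // j ≠ q} → Fin 2) → Matrix (Fin 2) (Fin 2) ℂ) →* Operator n where
  toFun f := (Matrix.blockDiagonal f).submatrix (Equiv.funSplitAt q (Fin 2))
    (Equiv.funSplitAt q (Fin 2))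
  map_one' := by rw [Matrix.blockDiagonal_one, Matrix.submatrix_one_equiv]
  map_mul' f g := by
    rw [Matrix.submatrix_mul_equiv, ← Matrix.blockDiagonal_mul]
    rfl

lemma blockOp_apply (q : Fin n) (f : ({j // j ≠ q} → Fin 2) → Matrix (Fin 2) (Fin 2) ℂ)
    (x y : Bits n) : blockOp q f x y =
      if (fun j : {j // j ≠ q} => x j) = (fun j : {j // j ≠ q} => y j)
        then f (fun j => x j) (x q) (y q) else 0 := rfl

lemma det_blockOp (q : Fin n) (f : ({j // j ≠ q} → Fin 2) → Matrix (Fin 2) (Fin 2) ℂ) :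
    (blockOp q f).det = ∏ z, (f z).det := by
  rw [← Matrix.det_blockDiagonal f]
  exact Matrix.det_submatrix_equiv_self _ _

lemma applyOn_oneQubit (e : Fin 1 ↪ Fin n) (M : Matrix (Fin 2) (Fin 2) ℂ) :
    applyOn e (oneQubit M) = blockOp (e 0) fun _ => M := by
  ext x y
  rw [blockOp_apply, applyOn]
  refine if_congr ?_ rfl rfl
  simp only [Fin.forall_fin_one, funext_iff, Subtype.forall]
  exact forall_congr' fun q => ⟨fun h h' => h h'.symm, fun h h' => h (Ne.symm h')⟩

/-- The basis state with bit `b` on qubit `q` and `z` on the others. -/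
def glue (q : Fin n) (b : Fin 2) (z : {j // j ≠ q} → Fin 2) : Bits n :=
  (Equiv.funSplitAt q (Fin 2)).symm (b, z)

lemma eq_glue_iff (q : Fin n) (b : Fin 2) (z : {j // j ≠ q} → Fin 2) (x : Bits n) :
    x = glue q b z ↔ x q = b ∧ (fun j : {j // j ≠ q} => x j) = z := by
  rw [glue, Equiv.eq_symm_apply, Prod.ext_iff]
  rfl

lemma glue_zero_ne_glue_one (q : Fin n) (z : {j // j ≠ q} → Fin 2) :
    glue q 0 z ≠ glue q 1 z := by
  rw [glue, glue, (Equiv.injective _).ne_iff]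
  simp

lemma blockOp_mulSingle (q : Fin n) (z : {j // j ≠ q} → Fin 2) (M : Matrix (Fin 2) (Fin 2) ℂ) :
    blockOp q (Pi.mulSingle z M) = twoLevel (glue q 0 z) (glue q 1 z) M := by
  ext x y
  rw [blockOp_apply, twoLevel]
  simp only [eq_glue_iff]
  have hxy : x = y ↔ x q = y q ∧
      (fun j : {j // j ≠ q} => x j) = (fun j : {j // j ≠ q} => y j) := by
    rw [← (Equiv.funSplitAt q (Fin 2)).injective.eq_iff, Prod.ext_iff]; rfl
  simp only [hxy]
  generalize (fun j : {j // j ≠ q} => x j) = u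
  generalize (fun j : {j // j ≠ q} => y j) = v
  generalize x q = a
  generalize y q = b
  by_cases hu : u = z
  · subst hu
    by_cases hv : u = v
    · subst hv
      fin_cases a <;> fin_cases b <;> simp
    · fin_cases a <;> fin_cases b <;> simp [hv, Ne.symm hv]
  · by_cases hv : u = v
    · subst hv
      simp [hu, Matrix.one_apply]
    · simp [hu, hv]

lemma exists_ne_of_four_le (hn : 4 ≤ n) (a b c : Fin n) : ∃ w, w ≠ a ∧ w ≠ b ∧ w ≠ c := by
  by_contra! h
  have h' : (Finset.univ : Finset (Fin n)) ⊆ {a, b, c} := fun x _ => by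
    have := h x
    simp only [Finset.mem_insert, Finset.mem_singleton]
    tauto
  have h1 := Finset.card_le_card h'
  have h2 := Finset.card_le_three (a := a) (b := b) (c := c)
  rw [Finset.card_univ, Fintype.card_fin] at h1
  omega

lemma det_matrix_X (hn : 4 ≤ n) (e : Fin 1 ↪ Fin n) :
    (PlacedGate.matrix ⟨.X, e⟩).det = 1 := by
  obtain ⟨w, hw, -⟩ := exists_ne_of_four_le hn (e 0) (e 0) (e 0)
  have := sign_ctrlNot (A := ∅) (B := ∅) (p := 1) hw (by simp) (by simp) (by simp)
  rw [Finset.union_empty] at this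
  rw [PlacedGate.matrix_X, det_permMatrixHom, this]
  simp

lemma det_matrix_CX (hn : 4 ≤ n) (e : Fin 2 ↪ Fin n) :
    (PlacedGate.matrix ⟨.CX, e⟩).det = 1 := by
  obtain ⟨w, hw0, hw1, -⟩ := exists_ne_of_four_le hn (e 0) (e 1) (e 1)
  have := sign_ctrlNot (A := ∅) (B := {e 0}) (p := 1) hw1 (by simp) (by simpa using hw0) (by simp)
  rw [Finset.empty_union] at this
  rw [PlacedGate.matrix_CX, det_permMatrixHom, this]
  simp

lemma det_matrix_CCX (hn : 4 ≤ n) (e : Fin 3 ↪ Fin n) :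
    (PlacedGate.matrix ⟨.CCX, e⟩).det = 1 := by
  obtain ⟨w, hw0, hw1, hw2⟩ := exists_ne_of_four_le hn (e 0) (e 1) (e 2)
  have h02 : e 2 ≠ e 0 := e.injective.ne (by decide)
  have := sign_ctrlNot (A := {e 0}) (B := {e 1}) (p := 1) hw2
    (by simpa using hw0) (by simpa using hw1) (by simp [h02])
  rw [Finset.singleton_union] at this
  rw [PlacedGate.matrix_CCX, det_permMatrixHom, this]
  simp

lemma PlacedGate.matrix_F (e : Fin 1 ↪ Fin n) :
    PlacedGate.matrix ⟨.F, e⟩ = blockOp (e 0) fun _ => matF :=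
  applyOn_oneQubit e matF

lemma det_matrix_F (hn : 4 ≤ n) (e : Fin 1 ↪ Fin n) :
    (PlacedGate.matrix ⟨.F, e⟩).det = 1 := by
  rw [PlacedGate.matrix_F, det_blockOp]
  simp only [det_matF, Finset.prod_const, Finset.card_univ, Fintype.card_fun, Fintype.card_fin]
  -- The exponent is the number `2 ^ (n - 1)` of blocks, even since `n > 1`.
  refine Even.neg_one_pow (Nat.even_pow.2 ⟨even_two, ?_⟩)
  simp
  omega

lemma det_placedGate (hn : 4 ≤ n) : ∀ p : PlacedGate n, p.matrix.det = 1
  | ⟨.X, e⟩ => det_matrix_X hn e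
  | ⟨.CX, e⟩ => det_matrix_CX hn e
  | ⟨.CCX, e⟩ => det_matrix_CCX hn e
  | ⟨.F, e⟩ => det_matrix_F hn e

lemma det_circuit (hn : 4 ≤ n) (c : Circuit n) : (Circuit.matrix c).det = 1 := by
  induction c with
  | nil => exact Matrix.det_one
  | cons p c ih => rw [Circuit.matrix, Matrix.det_mul, ih, det_placedGate hn, one_mul]

end Gates

/-! ### Isolating `F X` on one block, in the monoid of functions from blocks to matrices. -/

section PointwiseGates

variable {β G : Type*} [DecidableEq β] [Monoid G]

/-- The function equal to `M` on `T` and to `1` elsewhere. -/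
def constOn (T : Finset β) (M : G) : β → G := fun z => if z ∈ T then M else 1

lemma constOn_mul (T : Finset β) (M N : G) : constOn T M * constOn T N = constOn T (M * N) := by
  funext z
  simp only [constOn, Pi.mul_apply]
  split_ifs <;> simp

/-- Outside `T` the two constant factors cancel, so a gate available only on all blocks can still
conjugate on `T` alone. -/
lemma constOn_conj (T : Finset β) {F F' : G} (h : F * F' = 1) (M : G) :
    (fun _ => F) * constOn T M * (fun _ => F') = constOn T (F * M * F') := by
  funext z
  simp only [constOn, Pi.mul_apply]
  split_ifs <;> simp [h]

/-- On `y₁` and `y₂` only one of the two gates acts and it cancels its inverse; only the common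
block `y` sees the commutator. -/
lemma constOn_commutator {y y₁ y₂ : β} (h₁ : y ≠ y₁) (h₂ : y ≠ y₂) (h : y₁ ≠ y₂)
    {M M' N N' : G} (hM : M * M' = 1) (hN : N * N' = 1) :
    constOn {y, y₁} M * constOn {y, y₂} N * constOn {y, y₁} M' * constOn {y, y₂} N'
      = constOn {y} (M * N * M' * N') := by
  funext z
  simp only [constOn, Pi.mul_apply, Finset.mem_insert, Finset.mem_singleton]
  by_cases hy : z = y
  · subst hy; simp
  by_cases hy1 : z = y₁
  · subst hy1; simp [hy, h, hM]
  by_cases hy2 : z = y₂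
  · subst hy2; simp [hy, h.symm, hN]
  simp [hy, hy1, hy2]

/-- If the identity `F ^ 4 = (F * X) ^ 3` of the gates `F` and `X` holds in the form `hrel`, then
`F * X` on one block is generated by `F` on all blocks and `X` on pairs of blocks. -/
lemma constOn_singleton_mem (S : Submonoid (β → G)) {F F' X : G} (hF : F * F' = 1)
    (hF' : F' * F = 1) (hX : X * X = 1)
    (hpow : F' = F ^ 7) (hrel : F * X * F * X * F * X * F' * F' * F' = F)
    (hcF : (fun _ => F) ∈ S) (hpair : ∀ y y' : β, y ≠ y' → constOn {y, y'} X ∈ S)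
    {y y₁ y₂ : β} (h₁ : y ≠ y₁) (h₂ : y ≠ y₂) (h : y₁ ≠ y₂) : constOn {y} (F * X) ∈ S := by
  have hcF' : (fun _ => F') ∈ S := hpow ▸ S.pow_mem hcF 7
  have conj : ∀ (T : Finset β) (M : G), constOn T M ∈ S → constOn T (F * M * F') ∈ S :=
    fun T M hM => by
      rw [← constOn_conj T hF]
      exact S.mul_mem (S.mul_mem hcF hM) hcF'
  have mul : ∀ (T : Finset β) (M N : G), constOn T M ∈ S → constOn T N ∈ S →
      constOn T (M * N) ∈ S := fun T M N hM hN => by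
    rw [← constOn_mul]
    exact S.mul_mem hM hN
  have cancel : ∀ a, F' * (F * a) = a := fun a => by rw [← mul_assoc, hF', one_mul]
  -- By `hrel`, `F` is the product of the conjugates of `X` by `F`, `F ^ 2` and `F ^ 3`.
  have pairF : ∀ T : Finset β, constOn T X ∈ S → constOn T F ∈ S := fun T hT => by
    have h1 := conj T _ hT
    have h2 := conj T _ h1
    have h3 := conj T _ h2
    have := mul T _ _ (mul T _ _ h1 h2) h3
    convert this using 2
    conv_lhs => rw [← hrel]
    simp only [mul_assoc, cancel]
  have pairF' : ∀ T : Finset β, constOn T X ∈ S → constOn T F' ∈ S := fun T hT => by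
    have h1 := pairF T hT
    have h2 := mul T _ _ h1 h1
    rw [hpow, show F ^ 7 = F * F * (F * F) * (F * F) * F by
      simp only [pow_succ, pow_zero, one_mul, mul_assoc]]
    exact mul T _ _ (mul T _ _ (mul T _ _ h2 h2) h2) h1
  have cube : ∀ (T : Finset β) (M : G), constOn T M ∈ S → constOn T (M * M * M) ∈ S :=
    fun T M hM => mul T _ _ (mul T _ _ hM hM) hM
  have p₁ := hpair y y₁ h₁
  have p₂ := hpair y y₂ h₂
  have cancel' : ∀ a, F * (F' * a) = a := fun a => by rw [← mul_assoc, hF, one_mul]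
  have hcube : F * F * F * (F' * F' * F') = 1 := by simp only [mul_assoc, cancel', hF]
  have ha : constOn {y} (X * F * X * F') ∈ S := by
    rw [← constOn_commutator h₁ h₂ h hX hF]
    exact S.mul_mem (S.mul_mem (S.mul_mem p₁ (pairF _ p₂)) p₁) (pairF' _ p₂)
  have hb : constOn {y} (F * F * F * X * (F' * F' * F') * X) ∈ S := by
    rw [← constOn_commutator h₁ h₂ h hcube hX]
    exact S.mul_mem (S.mul_mem (S.mul_mem (cube _ _ (pairF _ p₁)) p₂)
      (cube _ _ (pairF' _ p₁))) p₂
  -- `F (X F X F') F' · F³ X F'³ X = (F X F X F X F'³) X`, which is `F X` by `hrel`.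
  convert mul _ _ _ (conj _ _ ha) hb using 2
  conv_lhs => rw [← hrel]
  simp only [mul_assoc, cancel]

end PointwiseGates

/-! ### From one two-level `F X` to all of them, and splitting off a permutation. -/

section TwoLevelCircuits

variable {n : ℕ}

/-- This is `(F X) ^ 3 = F ^ 4` in the form `hrel`: the left side is `(F X) ^ 3 F ^ 20 F = (-1) (-1)
^ 5 F`. -/
lemma matF_matX_relation :
    matF * matX * matF * matX * matF * matX * matF ^ 7 * matF ^ 7 * matF ^ 7 = matF := by
  have h1 : matF * matX * matF * matX * matF * matX * matF ^ 7 * matF ^ 7 * matF ^ 7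
      = (matF * matX) ^ 3 * (matF ^ 4) ^ 5 * matF := by noncomm_ring
  rw [h1, matF_mul_matX_pow_three, matF_pow_four]
  simp [pow_succ]

lemma constOn_singleton {β G : Type*} [DecidableEq β] [Monoid G] (y : β) (M : G) :
    constOn {y} M = Pi.mulSingle y M := by
  funext z
  simp [constOn, Pi.mulSingle_apply]

lemma constOn_pair {β G : Type*} [DecidableEq β] [Monoid G] {y y' : β} (h : y ≠ y') (M : G) :
    constOn {y, y'} M = Pi.mulSingle y M * Pi.mulSingle y' M := by
  funext z
  simp only [constOn, Pi.mulSingle_apply, Pi.mul_apply, Finset.mem_insert, Finset.mem_singleton]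
  by_cases h1 : z = y
  · subst h1; simp [h]
  · simp [h1]

/-- Some two-level operator of type `F X` is representable. -/
lemma exists_twoLevel_mem_representable (hn : 4 ≤ n) :
    ∃ a b : Bits n, a ≠ b ∧ twoLevel a b (matF * matX) ∈ representable n := by
  let q : Fin n := ⟨0, by omega⟩
  have hcard : 2 < Fintype.card ({j // j ≠ q} → Fin 2) := by
    rw [Fintype.card_fun, Fintype.card_fin]
    have : 2 ≤ Fintype.card {j // j ≠ q} := by simp; omega
    calc 2 < 2 ^ 2 := by norm_num
      _ ≤ _ := Nat.pow_le_pow_right (by norm_num) this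
  obtain ⟨y, y₁, y₂, h₁, h₂, h⟩ := Fintype.two_lt_card_iff.1 hcard
  refine ⟨_, _, glue_zero_ne_glue_one q y, ?_⟩
  rw [← blockOp_mulSingle, ← constOn_singleton]
  refine constOn_singleton_mem ((representable n).comap (blockOp q)) matF_mul_pow_seven
    matF_pow_seven_mul matX_mul_self rfl matF_matX_relation ?_ ?_ h₁ h₂ h
  · have := PlacedGate.matrix_mem ⟨.F, (⟨![q], Function.injective_of_subsingleton _⟩ :
      Fin 1 ↪ Fin n)⟩
    rw [PlacedGate.matrix_F] at this
    exact this
  · intro z z' hz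
    rw [Submonoid.mem_comap, constOn_pair hz, map_mul, blockOp_mulSingle, blockOp_mulSingle,
      twoLevel_matX (glue_zero_ne_glue_one q z), twoLevel_matX (glue_zero_ne_glue_one q z'),
      ← map_mul]
    -- `X` on two blocks is a product of two transpositions, hence even.
    refine permMatrixHom_mem_representable hn ?_
    rw [Perm.sign_mul, sign_swap (glue_zero_ne_glue_one q z),
      sign_swap (glue_zero_ne_glue_one q z')]
    rfl

lemma exists_even_perm {ι : Type*} [Fintype ι] [DecidableEq ι] (hι : 4 ≤ Fintype.card ι)
    {a b c d : ι} (hab : a ≠ b) (hcd : c ≠ d) :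
    ∃ σ : Perm ι, sign σ = 1 ∧ σ a = c ∧ σ b = d := by
  obtain ⟨σ, h1, h2⟩ : ∃ σ : Perm ι, σ a = c ∧ σ b = d := by
    refine ⟨swap (swap a c b) d * swap a c, ?_, ?_⟩
    · rw [Perm.mul_apply, swap_apply_left, swap_apply_of_ne_of_ne _ hcd]
      intro e
      exact hab ((swap a c).injective (by rw [swap_apply_left, ← e]))
    · rw [Perm.mul_apply, swap_apply_left]
  rcases Int.units_eq_one_or (sign σ) with h | h
  · exact ⟨σ, h, h1, h2⟩
  -- An odd `σ` is corrected by a transposition away from `c` and `d`.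
  · have hc : 1 < (Finset.univ \ {c, d} : Finset ι).card := by
      have := Finset.le_card_sdiff {c, d} (Finset.univ : Finset ι)
      have h2 := Finset.card_le_two (a := c) (b := d)
      rw [Finset.card_univ] at this
      omega
    obtain ⟨u, hu, v, hv, huv⟩ := Finset.one_lt_card.1 hc
    simp only [Finset.mem_sdiff, Finset.mem_univ, true_and, Finset.mem_insert,
      Finset.mem_singleton, not_or] at hu hv
    refine ⟨swap u v * σ, ?_, ?_, ?_⟩
    · rw [Perm.sign_mul, sign_swap huv, h]; rfl
    · rw [Perm.mul_apply, h1, swap_apply_of_ne_of_ne (Ne.symm hu.1) (Ne.symm hv.1)]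
    · rw [Perm.mul_apply, h2, swap_apply_of_ne_of_ne (Ne.symm hu.2) (Ne.symm hv.2)]

lemma twoLevel_mem_representable (hn : 4 ≤ n) {c d : Bits n} (hcd : c ≠ d) :
    twoLevel c d (matF * matX) ∈ representable n := by
  obtain ⟨a, b, hab, h⟩ := exists_twoLevel_mem_representable hn
  have hcard : 4 ≤ Fintype.card (Bits n) := by
    rw [Fintype.card_fun, Fintype.card_fin, Fintype.card_fin]
    calc 4 = 2 ^ 2 := by norm_num
      _ ≤ _ := Nat.pow_le_pow_right (by norm_num) (by omega)
  obtain ⟨σ, hσ, rfl, rfl⟩ := exists_even_perm hcard hab hcd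
  rw [← twoLevel_conj σ hab]
  exact mul_mem (mul_mem (permMatrixHom_mem_representable hn hσ) h)
    (permMatrixHom_mem_representable hn (by rw [sign_inv, hσ]))

/-- The even permutations and the two-level operators of type `F X`. -/
def evenGenerated (ι : Type*) [Fintype ι] [DecidableEq ι] : Submonoid (Matrix ι ι ℂ) :=
  Submonoid.closure ({V | ∃ σ : Perm ι, sign σ = 1 ∧ V = permMatrixHom (R := ℂ) σ} ∪
    {V | ∃ a b, a ≠ b ∧ V = twoLevel a b (matF * matX)})

/-- The submonoid generated by permutations and two-level operators of type `F`. -/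
def generated (ι : Type*) [Fintype ι] [DecidableEq ι] : Submonoid (Matrix ι ι ℂ) :=
  Submonoid.closure ({V | ∃ σ : Perm ι, V = permMatrixHom (R := ℂ) σ} ∪
    {V | ∃ a b, a ≠ b ∧ V = twoLevel a b matF})

lemma evenGenerated_le_representable (hn : 4 ≤ n) :
    evenGenerated (Bits n) ≤ representable n := by
  rw [evenGenerated, Submonoid.closure_le]
  rintro _ (⟨σ, hσ, rfl⟩ | ⟨a, b, hab, rfl⟩)
  · exact permMatrixHom_mem_representable hn hσ
  · exact twoLevel_mem_representable hn hab

section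

variable {ι : Type*} [Fintype ι] [DecidableEq ι]

lemma permMatrixHom_mul_inv (σ : Perm ι) :
    permMatrixHom (R := ℂ) σ * permMatrixHom (R := ℂ) σ⁻¹ = 1 := by
  rw [← map_mul, mul_inv_cancel, map_one]

lemma permMatrixHom_inv_mul (σ : Perm ι) :
    permMatrixHom (R := ℂ) σ⁻¹ * permMatrixHom (R := ℂ) σ = 1 := by
  rw [← map_mul, inv_mul_cancel, map_one]

/-- Both kinds of generators are stable under conjugation by arbitrary permutations, odd ones
included; this lets permutations be moved to the right of a product. -/
lemma conj_mem_evenGenerated (σ : Perm ι) {V : Matrix ι ι ℂ} (hV : V ∈ evenGenerated ι) :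
    permMatrixHom (R := ℂ) σ * V * permMatrixHom (R := ℂ) σ⁻¹ ∈ evenGenerated ι := by
  induction hV using Submonoid.closure_induction with
  | mem V h =>
    refine Submonoid.subset_closure ?_
    rcases h with ⟨τ, hτ, rfl⟩ | ⟨a, b, hab, rfl⟩
    · refine Or.inl ⟨σ * τ * σ⁻¹, ?_, by simp only [map_mul]⟩
      rw [Perm.sign_mul, Perm.sign_mul, hτ, sign_inv, mul_one, Int.units_mul_self]
    · exact Or.inr ⟨σ a, σ b, σ.injective.ne hab, twoLevel_conj σ hab _⟩
  | one => rw [mul_one, permMatrixHom_mul_inv]; exact one_mem _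
  | mul V W _ _ h1 h2 =>
    convert mul_mem h1 h2 using 1
    have := permMatrixHom_inv_mul σ
    simp only [mul_assoc, ← mul_assoc (permMatrixHom (R := ℂ) σ⁻¹), this, one_mul]

lemma exists_eq_mul_permMatrixHom {V : Matrix ι ι ℂ} (hV : V ∈ generated ι) :
    ∃ W ∈ evenGenerated ι, ∃ σ : Perm ι, V = W * permMatrixHom (R := ℂ) σ := by
  induction hV using Submonoid.closure_induction with
  | mem V h =>
    rcases h with ⟨σ, rfl⟩ | ⟨a, b, hab, rfl⟩
    · exact ⟨1, one_mem _, σ, (one_mul _).symm⟩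
    · refine ⟨_, Submonoid.subset_closure (Or.inr ⟨a, b, hab, rfl⟩), swap a b, ?_⟩
      rw [← twoLevel_matX hab, twoLevel_mul hab, mul_assoc, matX_mul_self, mul_one]
  | one => exact ⟨1, one_mem _, 1, by simp⟩
  | mul V W _ _ h1 h2 =>
    obtain ⟨V', hV', σ, rfl⟩ := h1
    obtain ⟨W', hW', τ, rfl⟩ := h2
    refine ⟨_, mul_mem hV' (conj_mem_evenGenerated σ hW'), σ * τ, ?_⟩
    rw [map_mul]
    have := permMatrixHom_inv_mul σ
    simp only [mul_assoc, ← mul_assoc (permMatrixHom (R := ℂ) σ⁻¹), this, one_mul]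

end

end TwoLevelCircuits

/-! ### The ring `ℤ[1/2, i√2]`. -/

section Arithmetic

lemma iSqrtTwo_mul_self : iSqrtTwo * iSqrtTwo = -2 := by rw [← pow_two, iSqrtTwo_sq]

lemma star_iSqrtTwo : star iSqrtTwo = -iSqrtTwo := by
  simp [iSqrtTwo]

lemma mem_dyadicSqrtNegTwo_iff {z : ℂ} : z ∈ dyadicSqrtNegTwo ↔
    ∃ (p q : ℤ) (k : ℕ), z * 2 ^ k = p + q * iSqrtTwo := by
  constructor
  · rintro ⟨_, ⟨u, a, rfl⟩, _, ⟨v, b, rfl⟩, rfl⟩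
    refine ⟨u * 2 ^ b, v * 2 ^ a, a + b, ?_⟩
    push_cast
    rw [pow_add]
    field_simp
  · rintro ⟨p, q, k, h⟩
    refine ⟨_, ⟨p, k, rfl⟩, _, ⟨q, k, rfl⟩, ?_⟩
    have : (2 : ℂ) ^ k ≠ 0 := pow_ne_zero _ two_ne_zero
    field_simp
    rw [h]

/-- The ring `ℤ[1/2, i√2]`. -/
def dyadicRing : Subring ℂ where
  carrier := dyadicSqrtNegTwo
  zero_mem' := mem_dyadicSqrtNegTwo_iff.2 ⟨0, 0, 0, by simp⟩
  one_mem' := mem_dyadicSqrtNegTwo_iff.2 ⟨1, 0, 0, by simp⟩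
  add_mem' {a b} ha hb := by
    obtain ⟨p, q, k, h⟩ := mem_dyadicSqrtNegTwo_iff.1 ha
    obtain ⟨r, t, l, h'⟩ := mem_dyadicSqrtNegTwo_iff.1 hb
    refine mem_dyadicSqrtNegTwo_iff.2 ⟨p * 2 ^ l + r * 2 ^ k, q * 2 ^ l + t * 2 ^ k, k + l, ?_⟩
    push_cast
    linear_combination (2 : ℂ) ^ l * h + 2 ^ k * h'
  neg_mem' {a} ha := by
    obtain ⟨p, q, k, h⟩ := mem_dyadicSqrtNegTwo_iff.1 ha
    refine mem_dyadicSqrtNegTwo_iff.2 ⟨-p, -q, k, ?_⟩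
    push_cast
    linear_combination -h
  mul_mem' {a b} ha hb := by
    obtain ⟨p, q, k, h⟩ := mem_dyadicSqrtNegTwo_iff.1 ha
    obtain ⟨r, t, l, h'⟩ := mem_dyadicSqrtNegTwo_iff.1 hb
    refine mem_dyadicSqrtNegTwo_iff.2 ⟨p * r - 2 * q * t, p * t + q * r, k + l, ?_⟩
    push_cast
    linear_combination (b * 2 ^ l) * h + (p + q * iSqrtTwo) * h' + q * t * iSqrtTwo_mul_self

lemma star_mem_dyadicRing {z : ℂ} (hz : z ∈ dyadicRing) : star z ∈ dyadicRing := by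
  obtain ⟨p, q, k, h⟩ := mem_dyadicSqrtNegTwo_iff.1 hz
  refine mem_dyadicSqrtNegTwo_iff.2 ⟨p, -q, k, ?_⟩
  have := congrArg star h
  simp only [star_mul', star_add, star_pow, star_iSqrtTwo, star_ofNat, star_intCast] at this
  rw [this]; push_cast; ring

lemma matF_apply_mem (i j : Fin 2) : matF i j ∈ dyadicRing := by
  refine mem_dyadicSqrtNegTwo_iff.2 ?_
  fin_cases i <;> fin_cases j
  · exact ⟨1, 1, 1, by simp [matF]; ring⟩
  · exact ⟨1, 0, 1, by simp [matF]⟩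
  · exact ⟨1, 0, 1, by simp [matF]⟩
  · exact ⟨-1, 1, 1, by simp [matF]; ring⟩

lemma matF_conjTranspose_mul : matFᴴ * matF = 1 := by
  have h := iSqrtTwo_mul_self
  have h' : (starRingEnd ℂ) iSqrtTwo = -iSqrtTwo := star_iSqrtTwo
  ext i j; fin_cases i <;> fin_cases j <;>
    simp [matF, Matrix.mul_apply, Fin.sum_univ_two, h', map_ofNat] <;>
    first | ring1 | linear_combination (-1 / 4 : ℂ) * h

end Arithmetic

/-! ### Unitary matrices over the ring, and the operators generated by permutations and two-level
`F`s. -/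

section Unitary

variable {ι : Type*} [Fintype ι] [DecidableEq ι]

/-- The unitary matrices over `ℤ[1/2, i√2]`. -/
def dyadicUnitary (ι : Type*) [Fintype ι] [DecidableEq ι] : Submonoid (Matrix ι ι ℂ) where
  carrier := {V | Vᴴ * V = 1 ∧ ∀ x y, V x y ∈ dyadicRing}
  one_mem' := by
    refine ⟨by simp, fun x y => ?_⟩
    rw [Matrix.one_apply]
    split_ifs
    exacts [one_mem _, zero_mem _]
  mul_mem' := by
    rintro V W ⟨hV, hV'⟩ ⟨hW, hW'⟩
    refine ⟨?_, fun x y => sum_mem fun z _ => mul_mem (hV' x z) (hW' z y)⟩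
    rw [conjTranspose_mul, mul_assoc, ← mul_assoc Vᴴ, hV, one_mul, hW]

lemma twoLevel_conjTranspose {κ : Type*} [DecidableEq κ] (a b : κ)
    (M : Matrix (Fin 2) (Fin 2) ℂ) (hab : a ≠ b) :
    (twoLevel a b M)ᴴ = twoLevel a b Mᴴ := by
  ext x y
  simp only [conjTranspose_apply, twoLevel]
  by_cases hxa : x = a
  · subst hxa
    by_cases hya : y = x
    · subst hya; simp
    · by_cases hyb : y = b
      · subst hyb; simp [hab.symm]
      · simp [hya, hyb]
  · by_cases hxb : x = b
    · subst hxb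
      by_cases hya : y = a
      · subst hya; simp [hab.symm]
      · by_cases hyb : y = x
        · subst hyb; simp [hab.symm]
        · simp [hya, hyb, hab.symm]
    · by_cases hya : y = a
      · subst hya; simp [hxa, hxb]
      · by_cases hyb : y = b
        · subst hyb; simp [hxa, hxb, hab.symm]
        · by_cases hxy : x = y
          · subst hxy; simp [hxa, hxb]
          · simp [hxa, hxb, hya, hyb, hxy, Ne.symm hxy]

lemma twoLevel_one {a b : ι} (hab : a ≠ b) : twoLevel a b 1 = 1 := by
  refine matrix_ext_mulVec fun v => ?_
  rw [twoLevel_mulVec hab, one_mulVec]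
  funext x
  split_ifs with h1 h2 <;> simp [*]

lemma generated_le_dyadicUnitary : generated ι ≤ dyadicUnitary ι := by
  rw [generated, Submonoid.closure_le]
  rintro _ (⟨σ, rfl⟩ | ⟨a, b, hab, rfl⟩)
  · refine ⟨?_, fun x y => ?_⟩
    · rw [permMatrixHom_apply, conjTranspose_permMatrix, ← permMatrix_mul]
      simp
    · rw [permMatrixHom_apply']
      split_ifs
      exacts [one_mem _, zero_mem _]
  · refine ⟨?_, fun x y => ?_⟩
    · rw [twoLevel_conjTranspose _ _ _ hab, twoLevel_mul hab, matF_conjTranspose_mul,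
        twoLevel_one hab]
    · unfold twoLevel
      split_ifs
      all_goals first | exact matF_apply_mem _ _ | exact one_mem _ | exact zero_mem _

lemma permMatrixHom_mem_generated (σ : Perm ι) : permMatrixHom (R := ℂ) σ ∈ generated ι :=
  Submonoid.subset_closure (Or.inl ⟨σ, rfl⟩)

lemma twoLevel_matF_mem_generated {a b : ι} (hab : a ≠ b) : twoLevel a b matF ∈ generated ι :=
  Submonoid.subset_closure (Or.inr ⟨a, b, hab, rfl⟩)

/-- `F ^ 6` inverts `F ^ 2 = i H`, with `H` Hadamard, so the middle part is `H X H = diag(1, -1)`;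
conjugating by `X` moves the sign to the first entry. -/
lemma matX_conj_eq_neg : matX * matF ^ 2 * matX * matF ^ 6 * matX = !![-1, 0; 0, 1] := by
  have h := iSqrtTwo_mul_self
  rw [show matF ^ 6 = matF ^ 4 * matF ^ 2 by rw [← pow_add], matF_pow_four, pow_two,
    matF_mul_self]
  ext i j; fin_cases i <;> fin_cases j <;>
    simp [matX, Matrix.mul_apply, Fin.sum_univ_two] <;>
    first | linear_combination (1 / 2 : ℂ) * h | linear_combination (-1 / 2 : ℂ) * h

/-- The `2 × 2` matrices whose two-level operators on `a` and `b` are generated. -/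
def twoLevelGenerated {a b : ι} (hab : a ≠ b) : Submonoid (Matrix (Fin 2) (Fin 2) ℂ) where
  carrier := {M | twoLevel a b M ∈ generated ι}
  one_mem' := by
    change twoLevel a b 1 ∈ generated ι
    rw [twoLevel_one hab]; exact one_mem _
  mul_mem' {M N} hM hN := by
    change twoLevel a b (M * N) ∈ generated ι
    rw [← twoLevel_mul hab]; exact mul_mem hM hN

lemma matF_mem_twoLevelGenerated {a b : ι} (hab : a ≠ b) : matF ∈ twoLevelGenerated hab :=
  twoLevel_matF_mem_generated hab

lemma neg_mem_twoLevelGenerated {a b : ι} (hab : a ≠ b) :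
    !![-1, 0; 0, 1] ∈ twoLevelGenerated hab := by
  have hX : matX ∈ twoLevelGenerated hab := by
    change twoLevel a b matX ∈ generated ι
    rw [twoLevel_matX hab]; exact permMatrixHom_mem_generated _
  have hF := matF_mem_twoLevelGenerated hab
  rw [← matX_conj_eq_neg]
  exact mul_mem (mul_mem (mul_mem (mul_mem hX (pow_mem hF 2)) hX) (pow_mem hF 6)) hX

end Unitary

/-! ### Reducing a pair of odd entries. -/

section ColumnReduction

variable {ι : Type*} [Fintype ι] [DecidableEq ι]

/-- The vector `v` is mapped to `c` times the basis vector at `t` by a generated operator that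
fixes the basis vectors of `T`. -/
def Reducible (T : Finset ι) (t : ι) (v : ι → ℂ) (c : ℂ) : Prop :=
  ∃ h ∈ generated ι, (∀ a ∈ T, h *ᵥ Pi.single a 1 = Pi.single a 1) ∧ h *ᵥ v = c • Pi.single t 1

variable {T : Finset ι} {t : ι} {v : ι → ℂ} {c : ℂ}

lemma Reducible.of_mulVec {g : Matrix ι ι ℂ} (hg : g ∈ generated ι)
    (hT : ∀ a ∈ T, g *ᵥ Pi.single a 1 = Pi.single a 1) (h : Reducible T t (g *ᵥ v) c) :
    Reducible T t v c := by
  obtain ⟨k, hk, hkT, hkv⟩ := h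
  refine ⟨k * g, mul_mem hk hg, fun a ha => ?_, ?_⟩
  · rw [← mulVec_mulVec, hT a ha, hkT a ha]
  · rw [← mulVec_mulVec, hkv]

lemma Reducible.smul (d : ℂ) (h : Reducible T t v c) : Reducible T t (d • v) (d * c) := by
  obtain ⟨k, hk, hkT, hkv⟩ := h
  exact ⟨k, hk, hkT, by rw [mulVec_smul, hkv, smul_smul]⟩

lemma twoLevel_mulVec_single {a b x : ι} (hab : a ≠ b) (ha : x ≠ a) (hb : x ≠ b)
    (M : Matrix (Fin 2) (Fin 2) ℂ) :
    twoLevel a b M *ᵥ Pi.single x 1 = Pi.single x 1 := by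
  rw [twoLevel_mulVec hab]
  funext y
  split_ifs with h1 h2
  · subst h1; simp [ha.symm, hb.symm]
  · subst h2; simp [ha.symm, hb.symm]
  · rfl

lemma exists_neg_mem_generated [Nontrivial ι] (t : ι) :
    ∃ N ∈ generated ι, ∀ v : ι → ℂ, N *ᵥ v = Function.update v t (-v t) := by
  obtain ⟨b, hb⟩ := exists_ne t
  refine ⟨_, neg_mem_twoLevelGenerated hb.symm, fun v => ?_⟩
  rw [twoLevel_mulVec hb.symm]
  funext x
  by_cases h1 : x = t
  · subst h1; simp
  · by_cases h2 : x = b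
    · subst h2; simp [h1]
    · simp [h1, h2]

lemma Reducible.neg [Nontrivial ι] (ht : t ∉ T) (h : Reducible T t v c) :
    Reducible T t v (-c) := by
  obtain ⟨k, hk, hkT, hkv⟩ := h
  obtain ⟨N, hN, hNv⟩ := exists_neg_mem_generated t
  refine ⟨N * k, mul_mem hN hk, fun a ha => ?_, ?_⟩
  · have : t ≠ a := fun e => ht (e ▸ ha)
    rw [← mulVec_mulVec, hkT a ha, hNv]
    simp [this]
  · rw [← mulVec_mulVec, hkv, hNv]
    funext x
    by_cases hx : x = t
    · subst hx; simp
    · simp [hx]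

lemma reducible_single (ht : t ∉ T) {j : ι} (hj : j ∉ T) : Reducible T t (Pi.single j 1) 1 := by
  refine ⟨_, permMatrixHom_mem_generated (swap j t), fun a ha => ?_, ?_⟩
  · rw [permMatrixHom_mulVec]
    have h1 : a ≠ j := fun e => hj (e ▸ ha)
    have h2 : a ≠ t := fun e => ht (e ▸ ha)
    funext x
    simp [Pi.single_apply, swap_apply_eq_iff, swap_apply_of_ne_of_ne h1 h2]
  · rw [permMatrixHom_mulVec, one_smul]
    funext x
    simp [Pi.single_apply, swap_apply_eq_iff]

/-- Two entries that are odd can be made even by a two-level operator. -/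
lemma exists_pair_reduction {a b : ι} (hab : a ≠ b) {p q r u : ℤ} (hp : Odd p) (hr : Odd r) :
    ∃ M ∈ twoLevelGenerated hab, ∃ p' q' r' u' : ℤ,
      M 0 0 * (p + q * iSqrtTwo) + M 0 1 * (r + u * iSqrtTwo) = p' + q' * iSqrtTwo ∧
      M 1 0 * (p + q * iSqrtTwo) + M 1 1 * (r + u * iSqrtTwo) = r' + u' * iSqrtTwo ∧
      Even p' ∧ Even r' ∧
      p' ^ 2 + 2 * q' ^ 2 + (r' ^ 2 + 2 * u' ^ 2) = p ^ 2 + 2 * q ^ 2 + (r ^ 2 + 2 * u ^ 2) := by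
  have hs := iSqrtTwo_mul_self
  have hF := matF_mem_twoLevelGenerated hab
  -- One `F` gives the rational parts `(p - 2q + r) / 2` and `(p - r - 2u) / 2`. Under these
  -- hypotheses both numerators are divisible by 4.
  have key : ∀ p q : ℤ, Odd p → Odd (q + u) → (4 : ℤ) ∣ p - 2 * q + r →
      ∃ p' q' r' u' : ℤ,
      matF 0 0 * (p + q * iSqrtTwo) + matF 0 1 * (r + u * iSqrtTwo) = p' + q' * iSqrtTwo ∧
      matF 1 0 * (p + q * iSqrtTwo) + matF 1 1 * (r + u * iSqrtTwo) = r' + u' * iSqrtTwo ∧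
      Even p' ∧ Even r' ∧
      p' ^ 2 + 2 * q' ^ 2 + (r' ^ 2 + 2 * u' ^ 2)
        = p ^ 2 + 2 * q ^ 2 + (r ^ 2 + 2 * u ^ 2) := by
    intro p q hp hq hd
    obtain ⟨m, hm⟩ := hd
    obtain ⟨p₁, rfl⟩ := hp
    obtain ⟨r₁, rfl⟩ := hr
    obtain ⟨w, hw⟩ := hq
    obtain rfl : u = 2 * w + 1 - q := by omega
    obtain rfl : r₁ = 2 * m - p₁ + q - 1 := by omega
    refine ⟨2 * m, p₁ + w + 1, 2 * (p₁ - m - w), 2 * q + 2 * m - p₁ - w - 1, ?_, ?_, ?_, ?_, ?_⟩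
    · simp [matF]
      linear_combination ((q : ℂ) / 2) * hs
    · simp [matF]
      linear_combination ((2 * w + 1 - q : ℂ) / 2) * hs
    · exact even_two_mul _
    · exact even_two_mul _
    · ring
  rcases Int.even_or_odd (q + u) with hq | hq
  -- Here `F ^ 2` gives rational parts `-(q + u)` and `q - u... ` up to sign, both even.
  · refine ⟨matF * matF, mul_mem hF hF, ?_⟩
    obtain ⟨p₁, rfl⟩ := hp
    obtain ⟨r₁, rfl⟩ := hr
    obtain ⟨w, hw⟩ := hq
    obtain rfl : u = w + w - q := by omega
    refine ⟨-2 * w, p₁ + r₁ + 1, 2 * (w - q), p₁ - r₁, ?_, ?_, ?_, ?_, ?_⟩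
    · rw [matF_mul_self]; simp
      linear_combination (w : ℂ) * hs
    · rw [matF_mul_self]; simp
      linear_combination (q - w : ℂ) * hs
    · rw [neg_mul]; exact (even_two_mul _).neg
    · exact even_two_mul _
    · ring
  · by_cases hd : (4 : ℤ) ∣ p - 2 * q + r
    · exact ⟨matF, hF, key p q hp hq hd⟩
    -- Now `p - 2q + r ≡ 2` mod 4; negating the first entry changes it to `-(p - 2q + r) + 2r ≡ 0`,
    -- as `r` is odd.
    · obtain ⟨p', q', r', u', h1, h2, h3, h4, h5⟩ := key (-p) (-q) hp.neg
        (by obtain ⟨w, hw⟩ := hq; exact ⟨w - q, by omega⟩)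
        (by obtain ⟨p₁, rfl⟩ := hp; obtain ⟨r₁, rfl⟩ := hr; obtain ⟨w, hw⟩ := hq; omega)
      refine ⟨matF * !![-1, 0; 0, 1], mul_mem hF (neg_mem_twoLevelGenerated hab),
        p', q', r', u', ?_, ?_, h3, h4, by linarith⟩
      · rw [← h1]; simp [Matrix.mul_apply, Fin.sum_univ_two]; ring
      · rw [← h2]; simp [Matrix.mul_apply, Fin.sum_univ_two]; ring

end ColumnReduction

/-! ### Reducing columns to basis vectors, and whole matrices to the identity. -/

section ColumnReduction

variable {ι : Type*} [Fintype ι] [DecidableEq ι]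

lemma sum_eq_add_add_sum {a b : ι} (hab : a ≠ b) (f : ι → ℤ) :
    ∑ i, f i = f a + f b + ∑ i ∈ (Finset.univ.erase a).erase b, f i := by
  rw [← Finset.add_sum_erase _ f (Finset.mem_univ a),
    ← Finset.add_sum_erase _ f (Finset.mem_erase.2 ⟨hab.symm, Finset.mem_univ b⟩), add_assoc]

/-- The vector with entries `p i + q i * i√2`. -/
noncomputable def intVec (p q : ι → ℤ) : ι → ℂ := fun i => p i + q i * iSqrtTwo

lemma reducible_of_sum_eq_one [Nontrivial ι] {T : Finset ι} {t : ι} (ht : t ∉ T) {p q : ι → ℤ}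
    (hT : ∀ a ∈ T, p a = 0 ∧ q a = 0) (hsum : ∑ i, (p i ^ 2 + 2 * q i ^ 2) = 1) :
    Reducible T t (intVec p q) 1 := by
  have hnn : ∀ i, 0 ≤ p i ^ 2 + 2 * q i ^ 2 := fun i => by positivity
  obtain ⟨j, -, hj⟩ := Finset.exists_ne_zero_of_sum_ne_zero (hsum.trans_ne one_ne_zero)
  have hj1 : 1 ≤ p j ^ 2 + 2 * q j ^ 2 := lt_of_le_of_ne (hnn j) (Ne.symm hj)
  rw [← Finset.add_sum_erase _ _ (Finset.mem_univ j)] at hsum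
  have hrest : ∑ i ∈ Finset.univ.erase j, (p i ^ 2 + 2 * q i ^ 2) = 0 :=
    le_antisymm (by linarith) (Finset.sum_nonneg fun i _ => hnn i)
  have hzero : ∀ i, i ≠ j → p i = 0 ∧ q i = 0 := fun i hi => by
    have := (Finset.sum_eq_zero_iff_of_nonneg fun i _ => hnn i).1 hrest i
      (Finset.mem_erase.2 ⟨hi, Finset.mem_univ i⟩)
    constructor <;> nlinarith [sq_nonneg (p i), sq_nonneg (q i)]
  have hjT : j ∉ T := fun h => hj (by simp [hT j h])
  have hqj : q j = 0 := by
    by_contra h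
    have : 0 < q j ^ 2 := by positivity
    nlinarith [sq_nonneg (p j)]
  have hpj : p j = 1 ∨ p j = -1 := by
    rw [← sq_eq_one_iff]; rw [hqj, hrest] at hsum; linarith
  have hv : intVec p q = (p j : ℂ) • Pi.single j 1 := by
    funext i
    by_cases hi : i = j
    · subst hi; simp [intVec, hqj]
    · simp [intVec, hi, hzero i hi]
  rw [hv]
  have h := reducible_single ht hjT
  rcases hpj with e | e
  · simpa [e] using h
  · simpa [e] using (h.smul (-1)).neg ht

/-- Double induction, on `k` and on the number of odd rational parts. When the norm is even, odd
entries come in pairs, which two-level operators make even without changing the norm; once none is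
left, `i√2` divides the vector and the norm halves. -/
lemma reducible_intVec [Nontrivial ι] {T : Finset ι} {t : ι} (ht : t ∉ T) (k : ℕ) :
    ∀ p q : ι → ℤ, (∀ a ∈ T, p a = 0 ∧ q a = 0) → ∑ i, (p i ^ 2 + 2 * q i ^ 2) = 2 ^ k →
      Reducible T t (intVec p q) (iSqrtTwo ^ k) := by
  induction k with
  | zero =>
    intro p q hT hsum
    rw [pow_zero] at hsum ⊢
    exact reducible_of_sum_eq_one ht hT hsum
  | succ k ih =>
    have main : ∀ (m : ℕ) (p q : ι → ℤ), (Finset.univ.filter fun i => Odd (p i)).card = m →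
        (∀ a ∈ T, p a = 0 ∧ q a = 0) → ∑ i, (p i ^ 2 + 2 * q i ^ 2) = 2 ^ (k + 1) →
        Reducible T t (intVec p q) (iSqrtTwo ^ (k + 1)) := by
      intro m
      induction m using Nat.strong_induction_on with
      | _ m ihm =>
        intro p q hm hT hsum
        by_cases hodd : ∃ a, Odd (p a)
        · obtain ⟨a, ha⟩ := hodd
          obtain ⟨b, hab, hb⟩ : ∃ b, a ≠ b ∧ Odd (p b) := by
            by_contra! hall
            have h2 : (2 : ℤ) ∣ ∑ i ∈ Finset.univ.erase a, (p i ^ 2 + 2 * q i ^ 2) := by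
              refine Finset.dvd_sum fun i hi => dvd_add ?_ (Dvd.intro _ rfl)
              have := hall i (Finset.ne_of_mem_erase hi).symm
              rw [Int.not_odd_iff_even] at this
              exact dvd_pow this.two_dvd two_ne_zero
            have h3 : (2 : ℤ) ∣ 2 ^ (k + 1) := dvd_pow_self 2 k.succ_ne_zero
            rw [← hsum, ← Finset.add_sum_erase _ _ (Finset.mem_univ a)] at h3
            have h4 := (Int.dvd_add_left h2).1 h3
            have h5 := (Int.dvd_add_left (Dvd.intro _ rfl : (2 : ℤ) ∣ 2 * q a ^ 2)).1 h4
            have h6 := Int.not_even_iff_odd.2 (ha.pow (n := 2))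
            exact h6 (even_iff_two_dvd.2 h5)
          have haT : a ∉ T := fun h => by simp [(hT a h).1] at ha
          have hbT : b ∉ T := fun h => by simp [(hT b h).1] at hb
          obtain ⟨M, hM, p', q', r', u', h1, h2, hp', hr', hn⟩ :=
            exists_pair_reduction (q := q a) (u := q b) hab ha hb
          let P : ι → ℤ := fun i => if i = a then p' else if i = b then r' else p i
          let Q : ι → ℤ := fun i => if i = a then q' else if i = b then u' else q i
          have hPa : P a = p' := if_pos rfl
          have hQa : Q a = q' := if_pos rfl
          have hPb : P b = r' := by simp [P, hab.symm]
          have hQb : Q b = u' := by simp [Q, hab.symm]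
          have hP : ∀ i, i ≠ a → i ≠ b → P i = p i := fun i h h' => by simp [P, h, h']
          have hQ : ∀ i, i ≠ a → i ≠ b → Q i = q i := fun i h h' => by simp [Q, h, h']
          refine Reducible.of_mulVec (g := twoLevel a b M) hM (fun x hx =>
            twoLevel_mulVec_single hab (fun e => haT (e ▸ hx)) (fun e => hbT (e ▸ hx)) M) ?_
          have hv : twoLevel a b M *ᵥ intVec p q = intVec P Q := by
            rw [twoLevel_mulVec hab]
            funext x
            by_cases hxa : x = a
            · subst hxa
              rw [if_pos rfl]
              exact h1.trans (by rw [intVec, hPa, hQa])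
            · by_cases hxb : x = b
              · subst hxb
                rw [if_neg hxa, if_pos rfl]
                exact h2.trans (by rw [intVec, hPb, hQb])
              · rw [if_neg hxa, if_neg hxb, intVec, intVec, hP x hxa hxb, hQ x hxa hxb]
          rw [hv]
          refine ihm _ ?_ P Q rfl (fun x hx => ?_) ?_
          · rw [← hm]
            refine Finset.card_lt_card (Finset.ssubset_iff_of_subset ?_ |>.2 ⟨a, ?_, ?_⟩)
            · intro i hi
              rw [Finset.mem_filter] at hi ⊢
              refine ⟨hi.1, ?_⟩
              by_cases hia : i = a
              · exact hia ▸ ha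
              by_cases hib : i = b
              · exact hib ▸ hb
              rw [← hP i hia hib]; exact hi.2
            · simpa using ha
            · simpa [hPa] using hp'
          · have e1 : x ≠ a := fun e => haT (e ▸ hx)
            have e2 : x ≠ b := fun e => hbT (e ▸ hx)
            rw [hP x e1 e2, hQ x e1 e2]; exact hT x hx
          · rw [sum_eq_add_add_sum hab] at hsum ⊢
            rw [hPa, hQa, hPb, hQb, hn, ← hsum]
            congr 1
            refine Finset.sum_congr rfl fun i hi => ?_
            simp only [Finset.mem_erase] at hi
            rw [hP i hi.2.1 hi.1, hQ i hi.2.1 hi.1]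
        · have heven : ∀ i, ∃ w, p i = 2 * w := fun i =>
            (Int.not_odd_iff_even.1 (fun h => hodd ⟨i, h⟩)).two_dvd
          choose w hw using heven
          -- `2w + q i√2 = i√2 (q - w i√2)`.
          have hv : intVec p q = iSqrtTwo • intVec q (-w) := by
            funext i
            simp only [intVec, Pi.smul_apply, smul_eq_mul, hw, Pi.neg_apply]
            push_cast
            linear_combination (w i : ℂ) * iSqrtTwo_mul_self
          rw [hv, pow_succ']
          refine (ih q (-w) (fun a ha => ⟨(hT a ha).2, ?_⟩) ?_).smul _
          · have := (hT a ha).1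
            have := hw a
            simp only [Pi.neg_apply]; omega
          · have h2 : ∑ i, (p i ^ 2 + 2 * q i ^ 2) = 2 * ∑ i, (q i ^ 2 + 2 * (-w) i ^ 2) := by
              rw [Finset.mul_sum]
              refine Finset.sum_congr rfl fun i _ => ?_
              rw [hw, Pi.neg_apply]; ring
            rw [h2, pow_succ'] at hsum
            exact mul_left_cancel₀ two_ne_zero hsum
    exact fun p q => main _ p q rfl

lemma reducible_of_mem_dyadicRing [Nontrivial ι] {T : Finset ι} {t : ι} (ht : t ∉ T) {v : ι → ℂ}
    (hv : ∀ i, v i ∈ dyadicRing) (hT : ∀ a ∈ T, v a = 0) (hnorm : ∑ i, star (v i) * v i = 1) :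
    Reducible T t v 1 := by
  have hv' := fun i => mem_dyadicSqrtNegTwo_iff.1 (hv i)
  choose p q k h using hv'
  let K := ∑ i, k i
  have hk : ∀ i, k i ≤ K := fun i => Finset.single_le_sum (fun _ _ => Nat.zero_le _)
    (Finset.mem_univ i)
  -- Setting the coefficients to zero on `T` avoids deducing this from `v a = 0`.
  let P : ι → ℤ := fun i => if i ∈ T then 0 else p i * 2 ^ (K - k i)
  let Q : ι → ℤ := fun i => if i ∈ T then 0 else q i * 2 ^ (K - k i)
  have hPQ : intVec P Q = (2 : ℂ) ^ K • v := by
    funext i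
    simp only [intVec, Pi.smul_apply, smul_eq_mul, P, Q]
    by_cases hi : i ∈ T
    · simp [hi, hT i hi]
    · simp only [if_neg hi]
      push_cast
      have : (2 : ℂ) ^ K = 2 ^ k i * 2 ^ (K - k i) := by
        rw [← pow_add, Nat.add_sub_cancel' (hk i)]
      rw [this]
      linear_combination -(2 : ℂ) ^ (K - k i) * h i
  have hsum : ∑ i, (P i ^ 2 + 2 * Q i ^ 2) = 2 ^ (2 * K) := by
    have hterm : ∀ i, ((P i ^ 2 + 2 * Q i ^ 2 : ℤ) : ℂ)
        = 2 ^ (2 * K) * (star (v i) * v i) := fun i => by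
      have e := congrFun hPQ i
      simp only [intVec, Pi.smul_apply, smul_eq_mul] at e
      have e' := congrArg star e
      simp only [star_mul', star_add, star_pow, star_iSqrtTwo, star_ofNat, star_intCast] at e'
      push_cast
      rw [two_mul K, pow_add]
      calc (P i : ℂ) ^ 2 + 2 * (Q i : ℂ) ^ 2
          = (P i + Q i * -iSqrtTwo) * (P i + Q i * iSqrtTwo) := by
            linear_combination (Q i : ℂ) ^ 2 * iSqrtTwo_mul_self
        _ = _ := by rw [e, e']; ring
    have : ((∑ i, (P i ^ 2 + 2 * Q i ^ 2) : ℤ) : ℂ) = ((2 ^ (2 * K) : ℤ) : ℂ) := by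
      rw [Int.cast_sum, Finset.sum_congr rfl fun i _ => hterm i, ← Finset.mul_sum, hnorm, mul_one]
      push_cast; rfl
    exact_mod_cast this
  have hred := reducible_intVec ht (2 * K) P Q (fun a ha => by simp [P, Q, ha]) hsum
  rw [hPQ] at hred
  have h2 : (2 : ℂ) ^ K ≠ 0 := pow_ne_zero _ two_ne_zero
  have hred' := hred.smul ((2 : ℂ) ^ K)⁻¹
  rw [smul_smul, inv_mul_cancel₀ h2, one_smul, pow_mul, iSqrtTwo_sq, neg_pow, mul_left_comm,
    inv_mul_cancel₀ h2, mul_one] at hred'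
  -- The scalar is `(i√2) ^ (2K) / 2 ^ K = (-1) ^ K`; a sign change at `t` removes it.
  rcases neg_one_pow_eq_or ℂ K with e | e <;> rw [e] at hred'
  · exact hred'
  · simpa using hred'.neg ht

/-- Induction on the number of columns not yet known to be basis vectors. Orthogonality to the fixed
columns makes column `t` vanish on `T`, so its reduction can leave them untouched. -/
lemma exists_mul_eq_one [Nontrivial ι] (m : ℕ) : ∀ (T : Finset ι), Tᶜ.card = m →
    ∀ V ∈ dyadicUnitary ι, (∀ a ∈ T, V *ᵥ Pi.single a 1 = Pi.single a 1) →
      ∃ h ∈ generated ι, h * V = 1 := by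
  induction m with
  | zero =>
    intro T hT V _ hfix
    rw [Finset.card_eq_zero, Finset.compl_eq_empty_iff] at hT
    refine ⟨1, one_mem _, ?_⟩
    rw [one_mul]
    refine Matrix.ext_of_mulVec_single fun a => ?_
    rw [hfix a (hT ▸ Finset.mem_univ a), one_mulVec]
  | succ m ih =>
    intro T hT V hV hfix
    obtain ⟨t, ht⟩ : Tᶜ.Nonempty := Finset.card_pos.1 (by omega)
    rw [Finset.mem_compl] at ht
    have hcol : ∀ a b, ∑ i, star (V i a) * V i b = (1 : Matrix ι ι ℂ) a b := fun a b => by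
      rw [← hV.1]; rfl
    have hentry : ∀ a ∈ T, ∀ i, V i a = (Pi.single a 1 : ι → ℂ) i := fun a ha i => by
      rw [← hfix a ha, mulVec_single_one]; rfl
    have hzero : ∀ a ∈ T, V a t = 0 := fun a ha => by
      have := hcol a t
      have hat : a ≠ t := fun e => ht (e ▸ ha)
      simpa [hentry a ha, Pi.single_apply, Matrix.one_apply, hat] using this
    obtain ⟨h, hh, hhT, hht⟩ := reducible_of_mem_dyadicRing ht (v := fun i => V i t)
      (fun i => hV.2 i t) hzero (by rw [hcol, Matrix.one_apply_eq])
    obtain ⟨g, hg, hgV⟩ := ih (insert t T) (by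
        rw [Finset.compl_insert, Finset.card_erase_of_mem (Finset.mem_compl.2 ht), hT]; rfl)
      (h * V) (mul_mem (generated_le_dyadicUnitary hh) hV) (by
        intro a ha
        rw [← mulVec_mulVec]
        rcases Finset.mem_insert.1 ha with rfl | ha
        · rw [mulVec_single_one]
          exact hht.trans (one_smul _ _)
        · rw [hfix a ha, hhT a ha])
    exact ⟨g * h, mul_mem hg hh, by rw [mul_assoc, hgV]⟩

lemma dyadicUnitary_le_generated [Nontrivial ι] : dyadicUnitary ι ≤ generated ι := by
  intro V hV
  have hV' : V * Vᴴ = 1 := mul_eq_one_comm.1 hV.1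
  -- Reducing `Vᴴ` instead of `V` yields `V` itself as the generated left inverse, so closure under
  -- inverses is not needed.
  obtain ⟨h, hh, e⟩ := exists_mul_eq_one _ (∅ : Finset ι) rfl Vᴴ
    ⟨by rw [conjTranspose_conjTranspose, hV'], fun x y => star_mem_dyadicRing (hV.2 y x)⟩
    (by simp)
  have : h = V := by rw [← mul_one h, ← hV.1, ← mul_assoc, e, one_mul]
  exact this ▸ hh

end ColumnReduction

lemma mem_representable_of_det_eq_one {n : ℕ} (hn : 4 ≤ n) {V : Operator n}
    (hV : V ∈ unitaryOver n dyadicSqrtNegTwo) (hdet : V.det = 1) : V ∈ representable n := by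
  have : Nonempty (Fin n) := ⟨⟨0, by omega⟩⟩
  have hmem : V ∈ dyadicUnitary (Bits n) := ⟨Matrix.mem_unitaryGroup_iff'.1 hV.1, hV.2⟩
  obtain ⟨W, hW, σ, rfl⟩ := exists_eq_mul_permMatrixHom (dyadicUnitary_le_generated hmem)
  have hW' := evenGenerated_le_representable hn hW
  -- `W` is itself a circuit, so the necessity direction gives its determinant.
  have hdetW : W.det = 1 := by
    obtain ⟨c, rfl⟩ := hW'
    exact det_circuit hn c
  rw [det_mul, hdetW, one_mul, det_permMatrixHom] at hdet
  have hσ : sign σ = 1 := by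
    rcases Int.units_eq_one_or (sign σ) with h | h
    · exact h
    · rw [h] at hdet; norm_num at hdet
  exact mul_mem hW' (permMatrixHom_mem_representable hn hσ)

end ImaginaryCircuit

theorem mainTheorem5 (n : ℕ) (hn : 4 ≤ n) (V : ImaginaryCircuit.Operator n)
    (hV : V ∈ ImaginaryCircuit.unitaryOver n ImaginaryCircuit.dyadicSqrtNegTwo) :
    ImaginaryCircuit.AncillaFreeRepresentable V ↔ V.det = 1 := by
  constructor
  · rintro ⟨c, rfl⟩
    exact ImaginaryCircuit.det_circuit hn c
  · exact ImaginaryCircuit.mem_representable_of_det_eq_one hn hV
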